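/- Let $p$ and $d$ be distinct primes, both larger than $3$, let $q=p^h$ with $h\ge 1$, and fix $\omega\in\mathbb F_{q^2}$ with $\omega^{q-1}=-1$. Let $\mathcal H_q$ be the Hermitian curve $y^q-y+\omega x^{q+1}=0$, let $Y_\infty=(0:1:0)$ be its point at infinity, and let $\mathrm{PGU}(3,q)\le \mathrm{PGL}(3,q^2)$ be the projective unitary group of the associated form $Y^qZ-YZ^q+\omega X^{q+1}$, i.e. the image in $\mathrm{PGL}(3,q^2)$ of the group of linear isometries of this form. For $a,b\in\mathbb F_{q^2}$ and $\lambda\in\mathbb F_{q^2}^*$ let $\varphi_{a,b,\lambda}\in\mathrm{PGL}(3,q^2)$ be the projectivity given in affine coordinates by $$(x,y)\mapsto(\lambda x+a,\ a^q\lambda\omega x+\lambda^{q+1}y+b).$$ Up to conjugacy in $\mathrm{PGU}(3,q)$ there are at most three subgroups of order $dp$ in $\mathrm{PGU}(3,q)$, and representatives can be chosen inside the stabiliser of $Y_\infty$ in $\mathrm{PGU}(3,q)$. More precisely, if $\mathrm{PGU}(3,q)$ has a subgroup $G$ of order $dp$, then $\mathbb F_{q^2}^*$ has elements of order $d$, and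 for every $\lambda\in\mathbb F_{q^2}^*$ of order $d$ the group $G$ is conjugate in $\mathrm{PGU}(3,q)$ to one of the following: (I) $\Sigma_p\times\Sigma_d$ with $\Sigma_p=\langle\varphi_{0,1,1}\rangle$, $\Sigma_d=\langle\varphi_{0,0,\lambda}\rangle$, and $d\mid q+1$; (II) $\Sigma_p\rtimes\Sigma_d$ with $\Sigma_p=\langle\varphi_{0,1,1}\rangle$, $\Sigma_d=\langle\varphi_{0,0,\lambda}\rangle$, and $d\mid p-1$ (so $d<p$); (III) $\Sigma_p\rtimes\Sigma_d$ with $\Sigma_p=\langle\varphi_{1,\omega/2,1}\rangle$, $\Sigma_d=\langle\varphi_{0,0,\lambda}\rangle$, and $d\mid p-1$ (so $d<p$). Conversely, for every $\lambda\in\mathbb F_{q^2}^*$ of order $d$, under the stated divisibility condition each of the groups (I), (II), (III) is a subgroup of order $dp$ of the stabiliser of $Y_\infty$ in $\mathrm{PGU}(3,q)$, with $|\Sigma_p|=p$ and $|\Sigma_d|=d$; it is the internal direct product (I) or semidirect product with normal factor $\Sigma_p$ (II, III) of $\Sigma_p$ and $\Sigma_d$; the group (I) is cyclic, and the groups (II)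 and (III) are not abelian. -/

import Mathlib

open scoped MatrixGroups LinearAlgebra.Projectivization

namespace Hermitian

variable {K : Type*} [Field K]

/-- The matrix of the form `ω X^{q+1} + Y^q Z - Z^q Y`, in the coordinates `(X, Y, Z)`, whose
isotropic points are the points of the Hermitian curve `y^q - y + ω x^{q+1} = 0`
(`x = X / Z`, `y = Y / Z`).  When `ω^{q-1} = -1`, its multiple by `ω` is a nondegenerate
Hermitian matrix, with the same isometries. -/
def formMatrix (ω : K) : Matrix (Fin 3) (Fin 3) K :=
  !![ω, 0, 0;
     0, 0, 1;
     0, -1, 0]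

/-- The group of isometries of the `σ`-sesquilinear form with matrix `J`: all invertible `A` with
`(A^σ)ᵀ J A = J`. -/
def isometryGroup (σ : K →+* K) (J : Matrix (Fin 3) (Fin 3) K) : Subgroup (GL (Fin 3) K) where
  carrier := {A | ((A : Matrix (Fin 3) (Fin 3) K).map σ).transpose * J * A = J}
  one_mem' := by simp
  mul_mem' := by
    intro A B hA hB
    simp only [Set.mem_ofPred_eq] at hA hB ⊢
    rw [Units.val_mul, Matrix.map_mul, Matrix.transpose_mul]
    calc _ = ((B : Matrix (Fin 3) (Fin 3) K).map σ).transpose *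
          (((A : Matrix (Fin 3) (Fin 3) K).map σ).transpose * J * A) * B := by
            simp only [mul_assoc]
      _ = J := by rw [hA, hB]
  inv_mem' := by
    intro A hA
    simp only [Set.mem_ofPred_eq] at hA ⊢
    have h : (((A⁻¹ : GL (Fin 3) K) : Matrix (Fin 3) (Fin 3) K).map σ).transpose *
        ((A : Matrix (Fin 3) (Fin 3) K).map σ).transpose = 1 := by
      rw [← Matrix.transpose_mul, ← Matrix.map_mul, Units.mul_inv]
      simp
    calc _ = (((A⁻¹ : GL (Fin 3) K) : Matrix (Fin 3) (Fin 3) K).map σ).transpose *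
          (((A : Matrix (Fin 3) (Fin 3) K).map σ).transpose * J * A) *
          ((A⁻¹ : GL (Fin 3) K) : Matrix (Fin 3) (Fin 3) K) := by rw [hA]
      _ = ((((A⁻¹ : GL (Fin 3) K) : Matrix (Fin 3) (Fin 3) K).map σ).transpose *
          ((A : Matrix (Fin 3) (Fin 3) K).map σ).transpose) * J *
          ((A : Matrix (Fin 3) (Fin 3) K) *
            ((A⁻¹ : GL (Fin 3) K) : Matrix (Fin 3) (Fin 3) K)) := by
            simp only [mul_assoc]
      _ = J := by rw [h, Units.mul_inv, one_mul, mul_one]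

/-- The unitary group `GU(3, q)`, `q = p^h`, of the Hermitian curve
`y^q - y + ω x^{q+1} = 0` over a field `K` with `q^2` elements; the involution of `K` is
`x ↦ x^q`. -/
def GU (p h : ℕ) [ExpChar K p] (ω : K) : Subgroup (GL (Fin 3) K) :=
  isometryGroup (iterateFrobenius K p h) (formMatrix ω)

/-- The projective unitary group `PGU(3, q)`: the image of `GU(3, q)` in `PGL(3, q^2)`. -/
def PGU (p h : ℕ) [ExpChar K p] (ω : K) : Subgroup PGL(3, K) :=
  (GU p h ω).map Matrix.ProjGenLinGroup.mk

/-- The point at infinity `(0 : 1 : 0)` of the Hermitian curve. -/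
def Yinf (K : Type*) [Field K] : ℙ K (Fin 3 → K) :=
  Projectivization.mk K ![0, 1, 0] (fun h => one_ne_zero (congrFun h 1))

/-- The stabiliser of `Y_∞` in `PGU(3, q)`. -/
def stabYinf (p h : ℕ) [ExpChar K p] (ω : K) : Subgroup PGL(3, K) :=
  PGU p h ω ⊓ MulAction.stabilizer PGL(3, K) (Yinf K)

/-- The projectivity `φ_{a,b,l}`, in affine coordinates
`(x, y) ↦ (l x + a, a^q l ω x + l^{q+1} y + b)`. -/
def phi (q : ℕ) (ω a b : K) (l : Kˣ) : PGL(3, K) :=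
  Matrix.ProjGenLinGroup.mk <| Matrix.GeneralLinearGroup.mkOfDetNeZero
    !![(l : K), 0, a;
       a ^ q * l * ω, (l : K) ^ (q + 1), b;
       0, 0, 1]
    (by simp [Matrix.det_fin_three])

/-- The group `⟨φ_{0,1,1}⟩`. -/
def sigmaCentral (q : ℕ) (ω : K) : Subgroup PGL(3, K) :=
  Subgroup.zpowers (phi q ω 0 1 1)

/-- The group `⟨φ_{1,ω/2,1}⟩`. -/
def sigmaNoncentral (q : ℕ) (ω : K) : Subgroup PGL(3, K) :=
  Subgroup.zpowers (phi q ω 1 (ω / 2) 1)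

/-- The group `⟨φ_{0,0,l}⟩`. -/
def sigmaDiag (q : ℕ) (ω : K) (l : Kˣ) : Subgroup PGL(3, K) :=
  Subgroup.zpowers (phi q ω 0 0 l)

/-- The subgroup generated by `⟨φ_{0,1,1}⟩` and `⟨φ_{0,0,l}⟩`. -/
def centralGroup (q : ℕ) (ω : K) (l : Kˣ) : Subgroup PGL(3, K) :=
  sigmaCentral q ω ⊔ sigmaDiag q ω l

/-- The subgroup generated by `⟨φ_{1,ω/2,1}⟩` and `⟨φ_{0,0,l}⟩`. -/
def noncentralGroup (q : ℕ) (ω : K) (l : Kˣ) : Subgroup PGL(3, K) :=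
  sigmaNoncentral q ω ⊔ sigmaDiag q ω l

end Hermitian

/-- `H` and `H'` are conjugate by an element of the subgroup `P`. -/
def ConjugateIn {G : Type*} [Group G] (P H H' : Subgroup G) : Prop :=
  ∃ g ∈ P, H.map (MulAut.conj g).toMonoidHom = H'

/-- `H` is the internal semidirect product `N ⋊ C` of its subgroups `N` (normal in `H`)
and `C`. -/
def IsInternalSemidirect {G : Type*} [Group G] (H N C : Subgroup G) : Prop :=
  N ≤ H ∧ C ≤ H ∧ (N.subgroupOf H).Normal ∧ (N.subgroupOf H).IsComplement' (C.subgroupOf H)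

/-- `H` is the internal direct product `N × C` of its subgroups `N` and `C`. -/
def IsInternalDirect {G : Type*} [Group G] (H N C : Subgroup G) : Prop :=
  IsInternalSemidirect H N C ∧ (C.subgroupOf H).Normal

/-!
A group of order `d * p` is generated by an element `x` of order `p` and an element `y` of order
`d`, one of which normalises the group generated by the other. If `x` normalises `⟨y⟩`, then
conjugation by `x` maps a matrix `B` of `y` to a polynomial in `B`. As `d ≠ p`, the matrix `B` is
diagonalisable over an algebraic closure; the polynomial permutes its at most three eigenvalues
with order dividing `p > 3`, hence trivially, so `x` and `y` commute. Thus `⟨x⟩` is normal in either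
case.

A matrix of `x` can be chosen unipotent in the isometry group. A nonzero vector in both the image
and the kernel of this matrix minus `1` is isotropic, so `x` fixes a point of the curve, and
transitivity moves this point to `Y_∞`. No other point of the curve is fixed by `x`, so `y` fixes
`Y_∞` too, and both are of the form `φ_{a,b,l}`. Conjugating by suitable translations turns `y`
into `φ_{0,0,l}`, and `x` is some `φ_{a,b,1}`. That `y` normalises `⟨x⟩` amounts to two equations in
`K`: they force `d ∣ (q + 1) (p - 1)` if `a = 0`, and `d ∣ p - 1` with `b = ω a^(q+1) / 2`
otherwise. A diagonal conjugation finally takes `(a, b)` to `(0, 1)` or to `(1, ω / 2)`.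
-/

section GroupTheory

variable {G : Type*} [Group G]

theorem ConjugateIn.trans {P H H' H'' : Subgroup G} (h₁ : ConjugateIn P H H')
    (h₂ : ConjugateIn P H' H'') : ConjugateIn P H H'' := by
  obtain ⟨g, hg, rfl⟩ := h₁
  obtain ⟨g', hg', rfl⟩ := h₂
  refine ⟨g' * g, mul_mem hg' hg, ?_⟩
  rw [Subgroup.map_map]
  congr 1
  ext z
  simp

theorem ConjugateIn.card_eq {P H H' : Subgroup G} (hHH' : ConjugateIn P H H') :
    Nat.card H = Nat.card H' := by
  obtain ⟨g, -, rfl⟩ := hHH'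
  exact (Subgroup.card_map_of_injective (MulAut.conj g).injective).symm

theorem map_conj_zpowers_sup (g x y : G) :
    (Subgroup.zpowers x ⊔ Subgroup.zpowers y).map (MulAut.conj g).toMonoidHom =
      Subgroup.zpowers (g * x * g⁻¹) ⊔ Subgroup.zpowers (g * y * g⁻¹) := by
  rw [Subgroup.map_sup, MonoidHom.map_zpowers, MonoidHom.map_zpowers]
  rfl

theorem mem_normalizer_zpowers_iff {x y : G} (hx : IsOfFinOrder x) :
    y ∈ Subgroup.normalizer (Subgroup.zpowers x : Set G) ↔ ∃ k : ℕ, y * x * y⁻¹ = x ^ k := by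
  constructor
  · intro hy
    have hmem := (Subgroup.mem_normalizer_iff.mp hy x).mp (Subgroup.mem_zpowers x)
    obtain ⟨k, hk⟩ := hx.mem_powers_iff_mem_zpowers.mpr hmem
    exact ⟨k, hk.symm⟩
  · rintro ⟨k, hk⟩
    have : Finite (Subgroup.zpowers x) := hx.finite_zpowers
    rw [Subgroup.mem_normalizer_iff_map_conj_eq, MonoidHom.map_zpowers]
    change Subgroup.zpowers (y * x * y⁻¹) = _
    refine Subgroup.eq_of_le_of_card_ge ?_ ?_
    · exact Subgroup.zpowers_le.mpr (hk ▸ pow_mem (Subgroup.mem_zpowers x) k)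
    · rw [Nat.card_zpowers, Nat.card_zpowers]
      exact (SemiconjBy.conj_mk y x).orderOf_eq.le

theorem isInternalSemidirect_sup {N C : Subgroup G} (hC : C ≤ Subgroup.normalizer (N : Set G))
    (hNC : Disjoint N C) : IsInternalSemidirect (N ⊔ C) N C := by
  have hnormal : (N.subgroupOf (N ⊔ C)).Normal := by
    rw [sup_comm]
    exact Subgroup.normal_subgroupOf_sup_of_le_normalizer hC
  refine ⟨le_sup_left, le_sup_right, hnormal,
    Subgroup.isComplement'_of_disjoint_and_mul_eq_univ ?_ ?_⟩
  · rw [disjoint_iff, Subgroup.subgroupOf, Subgroup.subgroupOf, ← Subgroup.comap_inf,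
      hNC.eq_bot, ← Subgroup.subgroupOf, Subgroup.bot_subgroupOf]
  · rw [← Subgroup.normal_mul, ← Subgroup.subgroupOf_sup le_sup_left le_sup_right,
      Subgroup.subgroupOf_self, Subgroup.coe_top]

theorem IsInternalSemidirect.card_mul_card {H N C : Subgroup G} (hH : IsInternalSemidirect H N C) :
    Nat.card N * Nat.card C = Nat.card H := by
  obtain ⟨hN, hC, -, hcompl⟩ := hH
  rw [← hcompl.card_mul_card, Nat.card_congr (Subgroup.subgroupOfEquivOfLe hN).toEquiv,
    Nat.card_congr (Subgroup.subgroupOfEquivOfLe hC).toEquiv]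

theorem isInternalDirect_sup_of_le_centralizer {N C : Subgroup G}
    (hN : N ≤ Subgroup.centralizer (C : Set G)) (hNC : Disjoint N C) :
    IsInternalDirect (N ⊔ C) N C :=
  ⟨isInternalSemidirect_sup
      ((Subgroup.le_centralizer_iff.mp hN).trans (Subgroup.centralizer_le_normalizer _)) hNC,
    Subgroup.normal_subgroupOf_sup_of_le_normalizer
      (hN.trans (Subgroup.centralizer_le_normalizer _))⟩

theorem zpowers_le_centralizer_zpowers_iff {x y : G} :
    Subgroup.zpowers x ≤ Subgroup.centralizer (Subgroup.zpowers y : Set G) ↔ Commute x y := by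
  rw [Subgroup.zpowers_le, Subgroup.zpowers_eq_closure y, Subgroup.centralizer_closure,
    Subgroup.mem_centralizer_singleton_iff]
  exact Iff.rfl

theorem IsInternalSemidirect.isCyclic_of_commute {H : Subgroup G} {x y : G}
    (hH : IsInternalSemidirect H (Subgroup.zpowers x) (Subgroup.zpowers y)) [Finite H]
    (hxy : Commute x y) (hcop : (orderOf x).Coprime (orderOf y)) : IsCyclic H := by
  have hmem : x * y ∈ H := mul_mem (hH.1 (Subgroup.mem_zpowers x)) (hH.2.1 (Subgroup.mem_zpowers y))
  refine isCyclic_of_orderOf_eq_card (⟨x * y, hmem⟩ : H) ?_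
  rw [Subgroup.orderOf_mk, hxy.orderOf_mul_eq_mul_orderOf_of_coprime hcop, ← Nat.card_zpowers,
    ← Nat.card_zpowers, hH.card_mul_card]

theorem normal_of_card_eq_of_lt {p d : ℕ} (hp : p.Prime) (hd : d.Prime) (hdp : d < p)
    (hG : Nat.card G = d * p) {N : Subgroup G} (hN : Nat.card N = p) : N.Normal := by
  have : Finite G := Nat.finite_of_card_ne_zero (hG ▸ mul_ne_zero hd.ne_zero hp.ne_zero)
  have hmin : (d * p).minFac = d := by
    refine le_antisymm (Nat.minFac_le_of_dvd hd.two_le (dvd_mul_right d p)) ?_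
    have hdp1 : d * p ≠ 1 := fun h1 => hd.one_lt.ne' (Nat.eq_one_of_mul_eq_one_right h1)
    refine (Nat.le_minFac.mpr fun r hr hrdp => ?_).resolve_left hdp1
    rcases (Nat.Prime.dvd_mul hr).mp hrdp with hrd | hrp
    · exact ((Nat.prime_dvd_prime_iff_eq hr hd).mp hrd).ge
    · exact hdp.le.trans ((Nat.prime_dvd_prime_iff_eq hr hp).mp hrp).ge
  have hidx := N.card_mul_index
  rw [hN, hG, mul_comm d, Nat.mul_left_cancel_iff hp.pos] at hidx
  exact Subgroup.normal_of_index_eq_minFac_card (by rw [hidx, hG, hmin])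

theorem exists_zpowers_sup_eq_top {p d : ℕ} (hp : p.Prime) (hd : d.Prime) (hpd : p ≠ d)
    (hG : Nat.card G = d * p) :
    ∃ x y : G, orderOf x = p ∧ orderOf y = d ∧ Subgroup.zpowers x ⊔ Subgroup.zpowers y = ⊤ ∧
      ((Subgroup.zpowers x).Normal ∨ (Subgroup.zpowers y).Normal) := by
  have : Finite G := Nat.finite_of_card_ne_zero (hG ▸ mul_ne_zero hd.ne_zero hp.ne_zero)
  have := Fact.mk hp
  have := Fact.mk hd
  obtain ⟨x, hx⟩ := exists_prime_orderOf_dvd_card' p (hG ▸ dvd_mul_left p d)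
  obtain ⟨y, hy⟩ := exists_prime_orderOf_dvd_card' d (hG ▸ dvd_mul_right d p)
  refine ⟨x, y, hx, hy, Subgroup.eq_top_of_le_card _ ?_, ?_⟩
  · have hpdvd : p ∣ Nat.card (Subgroup.zpowers x ⊔ Subgroup.zpowers y : Subgroup G) := by
      rw [← hx, ← Nat.card_zpowers]
      exact Subgroup.card_dvd_of_le le_sup_left
    have hddvd : d ∣ Nat.card (Subgroup.zpowers x ⊔ Subgroup.zpowers y : Subgroup G) := by
      rw [← hy, ← Nat.card_zpowers]
      exact Subgroup.card_dvd_of_le le_sup_right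
    rw [hG]
    exact Nat.le_of_dvd Nat.card_pos
      (((Nat.coprime_primes hd hp).mpr hpd.symm).mul_dvd_of_dvd_of_dvd hddvd hpdvd)
  · rcases lt_or_gt_of_ne hpd with hlt | hlt
    · exact Or.inr (normal_of_card_eq_of_lt hd hp hlt (by rw [hG, mul_comm])
        (by rw [Nat.card_zpowers, hy]))
    · exact Or.inl (normal_of_card_eq_of_lt hp hd hlt hG (by rw [Nat.card_zpowers, hx]))

theorem exists_zpowers_sup_eq {H : Subgroup G} {p d : ℕ} (hp : p.Prime) (hd : d.Prime)
    (hpd : p ≠ d) (hH : Nat.card H = d * p) :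
    ∃ x y : G, orderOf x = p ∧ orderOf y = d ∧ H = Subgroup.zpowers x ⊔ Subgroup.zpowers y ∧
      (y ∈ Subgroup.normalizer (Subgroup.zpowers x : Set G) ∨
        x ∈ Subgroup.normalizer (Subgroup.zpowers y : Set G)) := by
  obtain ⟨x, y, hx, hy, htop, hnormal⟩ := exists_zpowers_sup_eq_top hp hd hpd hH
  have mem_normalizer : ∀ u v : H, (Subgroup.zpowers u).Normal →
      (v : G) ∈ Subgroup.normalizer (Subgroup.zpowers (u : G) : Set G) := by
    intro u v hu
    have hv : v ∈ Subgroup.normalizer (Subgroup.zpowers u : Set H) :=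
      Subgroup.normalizer_eq_top (Subgroup.zpowers u) ▸ Subgroup.mem_top v
    have hv' := Subgroup.le_normalizer_map H.subtype (Subgroup.mem_map_of_mem H.subtype hv)
    rwa [MonoidHom.map_zpowers] at hv'
  refine ⟨x, y, by rw [Subgroup.orderOf_coe, hx], by rw [Subgroup.orderOf_coe, hy], ?_,
    hnormal.imp (mem_normalizer x y) (mem_normalizer y x)⟩
  have hmap := congrArg (Subgroup.map H.subtype) htop
  rw [Subgroup.map_sup, MonoidHom.map_zpowers, MonoidHom.map_zpowers, ← MonoidHom.range_eq_map,
    Subgroup.range_subtype] at hmap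
  exact hmap.symm

theorem conj_mem_normalizer_zpowers {x y : G}
    (hy : y ∈ Subgroup.normalizer (Subgroup.zpowers x : Set G)) (g : G) :
    g * y * g⁻¹ ∈ Subgroup.normalizer (Subgroup.zpowers (g * x * g⁻¹) : Set G) := by
  have hmem := Subgroup.le_normalizer_map (MulAut.conj g).toMonoidHom
    (Subgroup.mem_map_of_mem _ hy)
  rwa [MonoidHom.map_zpowers] at hmem

theorem smul_eq_of_mem_normalizer_zpowers {α : Type*} [MulAction G α] {x y : G}
    (hy : y ∈ Subgroup.normalizer (Subgroup.zpowers x : Set G)) {P : α} (hP : x • P = P) :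
    x • y • P = y • P := by
  have hx : y⁻¹ * x * y ∈ Subgroup.zpowers x := by
    simpa using (Subgroup.mem_normalizer_iff.mp (inv_mem hy) x).mp (Subgroup.mem_zpowers x)
  have hfix : y⁻¹ * x * y ∈ MulAction.stabilizer G P :=
    (Subgroup.zpowers_le.mpr (MulAction.mem_stabilizer_iff.mpr hP)) hx
  rw [MulAction.mem_stabilizer_iff, mul_smul, mul_smul, inv_smul_eq_iff] at hfix
  exact hfix

end GroupTheory

section Polynomial

open Polynomial

variable {F : Type*} [Field F]

theorem isFixedPt_of_isPeriodicPt_of_card_lt {α : Type*} {s : Finset α} {f : α → α}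
    (hf : Set.MapsTo f s s) {p : ℕ} (hp : p.Prime) (hs : s.card < p) {x : α} (hx : x ∈ s)
    (hfx : Function.IsPeriodicPt f p x) : Function.IsFixedPt f x := by
  have hmaps : ∀ n, f^[n] x ∈ s := fun n => hf.iterate n hx
  have hle : Function.minimalPeriod f x ≤ s.card := by
    simpa using Finset.card_le_card_of_injOn (s := Finset.range (Function.minimalPeriod f x))
      (fun n => f^[n] x) (fun n _ => hmaps n)
      (by simpa [Set.Iio_def] using Function.iterate_injOn_Iio_minimalPeriod (f := f) (x := x))
  rcases (Nat.dvd_prime hp).mp hfx.minimalPeriod_dvd with h1 | hp'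
  · exact Function.minimalPeriod_eq_one_iff_isFixedPt.mp h1
  · omega

theorem aeval_iterate_comp_X {A : Type*} [Ring A] [Algebra F A] (f : F[X]) (a : A) (n : ℕ) :
    aeval a (f.comp^[n] X) = (fun x => aeval x f)^[n] a := by
  induction n with
  | zero => exact aeval_X a
  | succ n ih => rw [Function.iterate_succ_apply', Function.iterate_succ_apply', aeval_comp, ih]

theorem iterate_aeval_eq_iterate_algHom {A : Type*} [Ring A] [Algebra F A] {σ : A →ₐ[F] A} {a : A}
    {f : F[X]} (hσ : σ a = aeval a f) (n : ℕ) : (fun x => aeval x f)^[n] a = σ^[n] a := by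
  induction n with
  | zero => rfl
  | succ n ih =>
    rw [Function.iterate_succ_apply', ih, Function.iterate_succ_apply, hσ, ← AlgHom.coe_pow,
      aeval_algHom_apply]

theorem dvd_of_separable_of_forall_aeval_eq_zero {m f : F[X]} (hm : m.Separable)
    (hroots : ∀ r : AlgebraicClosure F, aeval r m = 0 → aeval r f = 0) : m ∣ f := by
  rw [← Polynomial.map_dvd_map' (algebraMap F (AlgebraicClosure F))]
  by_cases hf : f = 0
  · simp [hf]
  have hm0 := hm.ne_zero
  refine ((IsAlgClosed.splits _).dvd_iff_roots_le_roots (map_ne_zero hm0) (map_ne_zero hf)).mpr ?_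
  refine (Multiset.le_iff_subset (nodup_roots hm.map)).mpr fun r hr => ?_
  rw [mem_roots_map hm0] at hr
  rw [mem_roots_map hf]
  exact hroots r hr

-- `f` permutes the roots of the minimal polynomial of `a`, of which there are fewer than `p`, and
-- its `p`-th iterate fixes them all, so `f` fixes each root.
theorem algHom_apply_eq_of_iterate_eq {A : Type*} [Ring A] [Algebra F A] {σ : A →ₐ[F] A} {a : A}
    {f : F[X]} (hσ : σ a = aeval a f) {p : ℕ} (hp : p.Prime) (hσp : σ^[p] a = a)
    (hsep : (minpoly F a).Separable) (hdeg : (minpoly F a).natDegree < p) : σ a = a := by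
  classical
  let E := AlgebraicClosure F
  let s : Finset E := (minpoly F a).rootSet E |>.toFinset
  have mem_s : ∀ r : E, r ∈ s ↔ aeval r (minpoly F a) = 0 := fun r => by
    rw [Set.mem_toFinset, mem_rootSet_of_ne hsep.ne_zero]
  have hmaps : Set.MapsTo (fun r : E => aeval r f) s s := fun r hr => by
    have hdvd : minpoly F a ∣ (minpoly F a).comp f := minpoly.dvd F a <| by
      rw [aeval_comp, ← hσ, aeval_algHom_apply, minpoly.aeval, map_zero]
    rw [SetLike.mem_coe, mem_s] at hr ⊢
    rw [← aeval_comp]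
    exact aeval_eq_zero_of_dvd_aeval_eq_zero hdvd hr
  have hperiod : ∀ r ∈ s, Function.IsPeriodicPt (fun r : E => aeval r f) p r := fun r hr => by
    have hdvd : minpoly F a ∣ f.comp^[p] X - X := minpoly.dvd F a <| by
      rw [map_sub, aeval_iterate_comp_X, iterate_aeval_eq_iterate_algHom hσ, hσp, aeval_X, sub_self]
    have := aeval_eq_zero_of_dvd_aeval_eq_zero hdvd ((mem_s r).mp hr)
    rwa [map_sub, aeval_iterate_comp_X, aeval_X, sub_eq_zero] at this
  have hcard : s.card < p := by
    refine lt_of_le_of_lt ?_ hdeg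
    rw [← Set.ncard_eq_toFinset_card']
    exact ncard_rootSet_le _ _
  have hdvd : minpoly F a ∣ f - X := dvd_of_separable_of_forall_aeval_eq_zero hsep fun r hr => by
    have hr := (mem_s r).mpr hr
    have := isFixedPt_of_isPeriodicPt_of_card_lt hmaps hp hcard hr (hperiod r hr)
    rw [map_sub, aeval_X, sub_eq_zero]
    exact this
  have := aeval_eq_zero_of_dvd_aeval_eq_zero hdvd (minpoly.aeval F a)
  rwa [map_sub, aeval_X, sub_eq_zero, ← hσ] at this

end Polynomial

section Nilpotent

theorem exists_apply_ne_zero_of_isNilpotent {R M : Type*} [Semiring R] [AddCommMonoid M]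
    [Module R M] {N : Module.End R M} (hN : IsNilpotent N) (hN0 : N ≠ 0) :
    ∃ w, N w ≠ 0 ∧ N (N w) = 0 := by
  have : Nontrivial (Module.End R M) := ⟨N, 0, hN0⟩
  obtain ⟨n, hn⟩ : ∃ n, nilpotencyClass N = n + 2 := by
    have h0 := (pos_nilpotencyClass_iff.mpr hN).ne'
    have h1 := mt nilpotencyClass_eq_one.mp hN0
    exact ⟨nilpotencyClass N - 2, by omega⟩
  obtain ⟨w, hw⟩ : ∃ w, (N ^ (n + 1)) w ≠ 0 := by
    by_contra! hzero
    exact pow_pred_nilpotencyClass hN (by rw [hn]; exact LinearMap.ext hzero)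
  refine ⟨(N ^ n) w, ?_, ?_⟩
  · rwa [← Module.End.mul_apply, ← pow_succ']
  · rw [← Module.End.mul_apply, ← Module.End.mul_apply, ← pow_two, ← pow_add, add_comm, ← hn,
      pow_nilpotencyClass hN, LinearMap.zero_apply]

end Nilpotent

section ProjectiveLinear

open Polynomial Matrix

variable {K : Type*} [Field K]

theorem commute_of_conj_eq_pow {n : Type*} [Fintype n] [DecidableEq n] {p d k : ℕ}
    (hp : p.Prime) (hn : Fintype.card n < p) (hd : (d : K) ≠ 0) {x y : ProjGenLinGroup n K}
    (hx : x ^ p = 1) (hy : y ^ d = 1) (hxy : x * y * x⁻¹ = y ^ k) : Commute x y := by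
  obtain ⟨A, rfl⟩ := ProjGenLinGroup.mk_surjective x
  obtain ⟨B, rfl⟩ := ProjGenLinGroup.mk_surjective y
  obtain ⟨μ, hμ⟩ : ∃ μ, B ^ k * GeneralLinearGroup.scalar n μ = A * B * A⁻¹ := by
    rw [← ProjGenLinGroup.mk_eq_mk_iff, map_pow, ← hxy, map_mul, map_mul, map_inv]
  obtain ⟨a, ha⟩ : ∃ a, 1 * GeneralLinearGroup.scalar n a = A ^ p := by
    rw [← ProjGenLinGroup.mk_eq_mk_iff, map_one, map_pow, hx]
  obtain ⟨c, hc⟩ : ∃ c, 1 * GeneralLinearGroup.scalar n c = B ^ d := by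
    rw [← ProjGenLinGroup.mk_eq_mk_iff, map_one, map_pow, hy]
  rw [one_mul] at ha hc
  let σ : Matrix n n K →ₐ[K] Matrix n n K :=
    MulSemiringAction.toAlgHom K _ (ConjAct.toConjAct A)
  have hσ : σ B.1 = aeval B.1 (C (μ : K) * X ^ k) := by
    change A.1 * B.1 * A⁻¹.1 = _
    rw [← Units.val_mul, ← Units.val_mul, ← hμ, map_mul, aeval_X_pow, aeval_C,
      ← Units.val_pow_eq_pow_val, Algebra.commutes]
    rfl
  have hσp : σ^[p] B.1 = B.1 := by
    change (ConjAct.toConjAct A • ·)^[p] B.1 = B.1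
    rw [smul_iterate_apply, ← map_pow, ← ha, ConjAct.units_smul_def, ConjAct.ofConjAct_toConjAct,
      ← Units.val_mul, GeneralLinearGroup.scalar_commute, ← Units.val_mul, mul_inv_cancel_right]
  have hsep : (minpoly K B.1).Separable := by
    refine (separable_X_pow_sub_C _ hd c.ne_zero).of_dvd (minpoly.dvd K _ ?_)
    rw [map_sub, aeval_X_pow, aeval_C, ← Units.val_pow_eq_pow_val, ← hc,
      GeneralLinearGroup.coe_scalar, sub_eq_zero]
    rfl
  have hdeg : (minpoly K B.1).natDegree < p := by
    refine lt_of_le_of_lt ?_ hn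
    rw [← charpoly_natDegree_eq_dim B.1]
    exact natDegree_le_of_dvd (minpoly_dvd_charpoly B.1) (charpoly_monic B.1).ne_zero
  have hfix : A * B * A⁻¹ = B := Units.ext (algHom_apply_eq_of_iterate_eq hσ hp hσp hsep hdeg)
  exact Commute.map (mul_inv_eq_iff_eq_mul.mp hfix) ProjGenLinGroup.mk

theorem exists_zpowers_sup_eq_of_card_eq {n : Type*} [Fintype n] [DecidableEq n] {p d : ℕ}
    (hp : p.Prime) (hn : Fintype.card n < p) (hd : d.Prime) (hdK : (d : K) ≠ 0) (hpd : p ≠ d)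
    {H : Subgroup (ProjGenLinGroup n K)} (hH : Nat.card H = d * p) :
    ∃ x y, orderOf x = p ∧ orderOf y = d ∧ H = Subgroup.zpowers x ⊔ Subgroup.zpowers y ∧
      y ∈ Subgroup.normalizer (Subgroup.zpowers x : Set (ProjGenLinGroup n K)) := by
  obtain ⟨x, y, hx, hy, hHxy, hnorm⟩ := exists_zpowers_sup_eq hp hd hpd hH
  refine ⟨x, y, hx, hy, hHxy, hnorm.elim id fun hxy => ?_⟩
  have hx' : IsOfFinOrder x := orderOf_pos_iff.mp (hx ▸ hp.pos)
  have hy' : IsOfFinOrder y := orderOf_pos_iff.mp (hy ▸ hd.pos)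
  obtain ⟨k, hk⟩ := (mem_normalizer_zpowers_iff hy').mp hxy
  have hcomm : Commute x y := commute_of_conj_eq_pow hp hn hdK (hx ▸ pow_orderOf_eq_one x)
    (hy ▸ pow_orderOf_eq_one y) hk
  exact (mem_normalizer_zpowers_iff hx').mpr ⟨1, by rw [← hcomm.eq, mul_inv_cancel_right, pow_one]⟩

end ProjectiveLinear

section FiniteField

theorem exists_pow_eq_of_pow_eq_one {G : Type*} [Group G] [Finite G] [IsCyclic G] {m n : ℕ}
    (hG : Nat.card G = m * n) {x : G} (hx : x ^ m = 1) : ∃ y : G, y ^ n = x := by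
  obtain ⟨g, hg⟩ := IsCyclic.exists_generator (α := G)
  obtain ⟨j, rfl⟩ := (isOfFinOrder_of_finite g).mem_powers_iff_mem_zpowers.mpr (hg x)
  change (g ^ j) ^ m = 1 at hx
  have hdvd : n * m ∣ j * m := by
    rw [mul_comm n, ← hG, ← orderOf_eq_card_of_forall_mem_zpowers hg]
    exact orderOf_dvd_of_pow_eq_one (by rw [pow_mul, hx])
  have hm : 0 < m := Nat.pos_of_ne_zero fun hm0 => Nat.card_pos.ne' (by rw [hG, hm0, zero_mul])
  obtain ⟨i, rfl⟩ := Nat.dvd_of_mul_dvd_mul_right hm hdvd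
  exact ⟨g ^ i, by rw [← pow_mul, mul_comm]⟩

variable {K : Type*} [Field K]

theorem exponent_ne_zero_of_card_eq [Finite K] {p h : ℕ} (hK : Nat.card K = (p ^ h) ^ 2) :
    h ≠ 0 := by
  rintro rfl
  exact (Finite.one_lt_card (α := K)).ne' (by rw [hK, pow_zero, one_pow])

theorem pow_pow_eq_self_of_card_eq [Finite K] {q : ℕ} (hK : Nat.card K = q ^ 2) (x : K) :
    (x ^ q) ^ q = x := by
  have := Fintype.ofFinite K
  rw [← pow_mul, ← pow_two, ← hK, Nat.card_eq_fintype_card, FiniteField.pow_card]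

theorem pow_sub_one_eq_one_iff {q : ℕ} (hq : q ≠ 0) {u : Kˣ} :
    u ^ (q - 1) = 1 ↔ (u : K) ^ q = u := by
  rw [← pow_sub_one_mul hq, mul_eq_right₀ u.ne_zero, ← Units.val_pow_eq_pow_val, Units.val_eq_one]

theorem exists_pow_succ_eq [Finite K] {q : ℕ} (hK : Nat.card K = q ^ 2) {b : K} (hb0 : b ≠ 0)
    (hb : b ^ q = b) : ∃ m : Kˣ, (m : K) ^ (q + 1) = b := by
  have hq : q ≠ 0 := by
    rintro rfl
    exact Nat.card_pos.ne' hK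
  have hcard : Nat.card Kˣ = (q - 1) * (q + 1) := by
    rw [Nat.card_units, hK, mul_comm, ← Nat.sq_sub_sq, one_pow]
  obtain ⟨m, hm⟩ := exists_pow_eq_of_pow_eq_one hcard
    ((pow_sub_one_eq_one_iff hq (u := Units.mk0 b hb0)).mpr hb)
  exact ⟨m, by rw [← Units.val_pow_eq_pow_val, hm, Units.val_mk0]⟩

theorem exists_natCast_eq_iff (p : ℕ) [Fact p.Prime] [CharP K p] {u : Kˣ} :
    (∃ k : ℕ, (u : K) = k) ↔ orderOf u ∣ p - 1 := by
  have hp : p.Prime := Fact.out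
  rw [orderOf_dvd_iff_pow_eq_one, pow_sub_one_eq_one_iff hp.ne_zero,
    ← Subfield.mem_bot_iff_pow_eq_self, ← ZMod.fieldRange_castHom_eq_bot p]
  constructor
  · rintro ⟨k, hk⟩
    exact ⟨k, by rw [hk, map_natCast]⟩
  · rintro ⟨z, hz⟩
    obtain ⟨k, rfl⟩ := ZMod.natCast_zmod_surjective z
    exact ⟨k, by rw [← hz, map_natCast]⟩

theorem pow_pow_eq_self_of_orderOf_dvd (p h : ℕ) [Fact p.Prime] [CharP K p] {u : Kˣ}
    (hu : orderOf u ∣ p - 1) : (u : K) ^ p ^ h = u := by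
  obtain ⟨k, hk⟩ := (exists_natCast_eq_iff p).mpr hu
  rw [hk, ← iterateFrobenius_def, map_natCast]

end FiniteField

namespace Hermitian

section Phi

variable {K : Type*} [Field K]

/-- The matrix representing `φ_{a,b,l}` whose last row is `(0, 0, 1)`. -/
def phiGL (q : ℕ) (ω a b : K) (l : Kˣ) : GL (Fin 3) K :=
  Matrix.GeneralLinearGroup.mkOfDetNeZero
    !![(l : K), 0, a;
       a ^ q * l * ω, (l : K) ^ (q + 1), b;
       0, 0, 1]
    (by simp [Matrix.det_fin_three])

theorem coe_phiGL (q : ℕ) (ω a b : K) (l : Kˣ) :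
    (phiGL q ω a b l : Matrix (Fin 3) (Fin 3) K) =
      !![(l : K), 0, a; a ^ q * l * ω, (l : K) ^ (q + 1), b; 0, 0, 1] := rfl

theorem mk_phiGL (q : ℕ) (ω a b : K) (l : Kˣ) :
    Matrix.ProjGenLinGroup.mk (phiGL q ω a b l) = phi q ω a b l := rfl

theorem coe_phiGL_mul_scalar (q : ℕ) (ω a b : K) (l c : Kˣ) :
    ((phiGL q ω a b l * Matrix.GeneralLinearGroup.scalar (Fin 3) c : GL (Fin 3) K) :
        Matrix (Fin 3) (Fin 3) K) =
      !![(l : K) * c, 0, a * c;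
         a ^ q * l * ω * c, (l : K) ^ (q + 1) * c, b * c;
         0, 0, (c : K)] := by
  rw [Units.val_mul, coe_phiGL, Matrix.GeneralLinearGroup.coe_scalar, Matrix.scalar_apply]
  ext i j
  rw [Matrix.mul_diagonal]
  fin_cases i <;> fin_cases j <;> simp

theorem phi_inj {q : ℕ} {ω a b a' b' : K} {l l' : Kˣ} :
    phi q ω a b l = phi q ω a' b' l' ↔ a = a' ∧ b = b' ∧ l = l' := by
  refine ⟨fun e => ?_, by rintro ⟨rfl, rfl, rfl⟩; rfl⟩
  rw [← mk_phiGL, ← mk_phiGL, Matrix.ProjGenLinGroup.mk_eq_mk_iff] at e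
  obtain ⟨u, hu⟩ := e
  have hM := congrArg Units.val hu
  rw [coe_phiGL_mul_scalar, coe_phiGL] at hM
  have hu1 : (u : K) = 1 := congrFun₂ hM 2 2
  simp only [hu1, mul_one] at hM
  exact ⟨congrFun₂ hM 0 2, congrFun₂ hM 1 2, Units.ext (congrFun₂ hM 0 0)⟩

variable (p h : ℕ) [Fact p.Prime] (ω : K)

theorem phi_one : phi (p ^ h) ω 0 0 1 = 1 := by
  have hp : p ≠ 0 := (Fact.out : p.Prime).ne_zero
  suffices e : phiGL (p ^ h) ω 0 0 1 = 1 by rw [← mk_phiGL, e, map_one]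
  apply Units.ext
  rw [coe_phiGL]
  ext i j
  fin_cases i <;> fin_cases j <;> simp [hp]

theorem phi_eq_one_iff {a b : K} {l : Kˣ} :
    phi (p ^ h) ω a b l = 1 ↔ a = 0 ∧ b = 0 ∧ l = 1 := by
  rw [← phi_one p h ω, phi_inj]

variable [CharP K p]

theorem phi_mul (a b a' b' : K) (l l' : Kˣ) :
    phi (p ^ h) ω a b l * phi (p ^ h) ω a' b' l' =
      phi (p ^ h) ω (a + l * a') (b + a ^ p ^ h * l * ω * a' + l ^ (p ^ h + 1) * b') (l * l') := by
  simp only [← mk_phiGL, ← map_mul]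
  congr 1
  apply Units.ext
  rw [Units.val_mul, coe_phiGL, coe_phiGL, coe_phiGL]
  ext i j
  fin_cases i <;> fin_cases j <;>
    simp [Matrix.mul_apply, Fin.sum_univ_three, add_pow_char_pow, mul_pow] <;> ring

theorem phi_translation_pow (a b : K) (k : ℕ) :
    phi (p ^ h) ω a b 1 ^ k =
      phi (p ^ h) ω (k * a) (k * b + (k.choose 2 : K) * (ω * a ^ (p ^ h + 1))) 1 := by
  induction k with
  | zero => simp [phi_one]
  | succ k ih =>
    rw [pow_succ', ih, phi_mul, phi_inj, Nat.choose_succ_succ' k 1]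
    push_cast
    rw [Nat.choose_one_right]
    exact ⟨by ring, by ring, mul_one 1⟩

theorem exists_phi_pow_eq (a b : K) (l : Kˣ) (k : ℕ) :
    ∃ a' b', phi (p ^ h) ω a b l ^ k = phi (p ^ h) ω a' b' (l ^ k) := by
  induction k with
  | zero => exact ⟨0, 0, by rw [pow_zero, pow_zero, phi_one]⟩
  | succ k ih =>
    obtain ⟨a', b', e⟩ := ih
    rw [pow_succ, e, phi_mul, pow_succ l]
    exact ⟨_, _, rfl⟩

theorem phi_vertical_pow (b : K) {l : Kˣ} (hl : (l : K) ^ (p ^ h + 1) = 1) (k : ℕ) :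
    phi (p ^ h) ω 0 b l ^ k = phi (p ^ h) ω 0 (k * b) (l ^ k) := by
  induction k with
  | zero => simp [phi_one]
  | succ k ih =>
    rw [pow_succ', ih, phi_mul, hl, pow_succ' l, phi_inj]
    refine ⟨by ring, ?_, rfl⟩
    push_cast
    ring

/-- The diagonal embedding `l ↦ φ_{0,0,l}` as a group homomorphism. -/
def phiDiagHom : Kˣ →* PGL(3, K) :=
  MonoidHom.mk' (fun l => phi (p ^ h) ω 0 0 l) fun l l' => by
    rw [phi_mul, phi_inj]
    exact ⟨by ring, by ring, rfl⟩

theorem phiDiagHom_apply (l : Kˣ) : phiDiagHom p h ω l = phi (p ^ h) ω 0 0 l := rfl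

theorem phiDiagHom_injective : Function.Injective (phiDiagHom p h ω) :=
  fun _ _ e => (phi_inj.mp e).2.2

theorem phi_diag_conj (a b : K) (m l : Kˣ) :
    phi (p ^ h) ω 0 0 m * phi (p ^ h) ω a b l * (phi (p ^ h) ω 0 0 m)⁻¹ =
      phi (p ^ h) ω (m * a) (m ^ (p ^ h + 1) * b) l := by
  have hp : p ≠ 0 := (Fact.out : p.Prime).ne_zero
  rw [mul_inv_eq_iff_eq_mul, phi_mul, phi_mul, phi_inj]
  simp [hp, mul_comm]

theorem phi_vertical_conj (t b : K) (l : Kˣ) :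
    phi (p ^ h) ω 0 t 1 * phi (p ^ h) ω 0 b l * (phi (p ^ h) ω 0 t 1)⁻¹ =
      phi (p ^ h) ω 0 (b + t - l ^ (p ^ h + 1) * t) l := by
  rw [mul_inv_eq_iff_eq_mul, phi_mul, phi_mul, phi_inj]
  refine ⟨by ring, ?_, mul_comm _ _⟩
  rw [Units.val_one]
  ring

theorem exists_phi_translation_conj_eq (s t a b : K) (l : Kˣ) :
    ∃ b', phi (p ^ h) ω s t 1 * phi (p ^ h) ω a b l * (phi (p ^ h) ω s t 1)⁻¹ =
      phi (p ^ h) ω (a + s - l * s) b' l := by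
  refine ⟨t + s ^ p ^ h * ω * a + b - (a + s - l * s) ^ p ^ h * l * ω * s
    - l ^ (p ^ h + 1) * t, ?_⟩
  rw [mul_inv_eq_iff_eq_mul, phi_mul, phi_mul, phi_inj, Units.val_one]
  exact ⟨by ring, by ring, mul_comm _ _⟩

theorem orderOf_phi_diag (l : Kˣ) : orderOf (phi (p ^ h) ω 0 0 l) = orderOf l := by
  rw [← phiDiagHom_apply, orderOf_injective _ (phiDiagHom_injective p h ω)]

theorem sigmaDiag_eq_map (l : Kˣ) :
    sigmaDiag (p ^ h) ω l = (Subgroup.zpowers l).map (phiDiagHom p h ω) := by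
  rw [MonoidHom.map_zpowers, phiDiagHom_apply, sigmaDiag]

theorem phi_translation_pow_char (hp2 : p ≠ 2) (a b : K) : phi (p ^ h) ω a b 1 ^ p = 1 := by
  have hp : p.Prime := Fact.out
  have hc : (p.choose 2 : K) = 0 := (CharP.cast_eq_zero_iff K p _).mpr
    (hp.dvd_choose_self two_ne_zero (hp.two_le.lt_of_ne' hp2))
  rw [phi_translation_pow, phi_eq_one_iff, hc]
  simp

theorem isOfFinOrder_phi_translation (hp2 : p ≠ 2) (a b : K) :
    IsOfFinOrder (phi (p ^ h) ω a b 1) :=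
  isOfFinOrder_iff_pow_eq_one.mpr
    ⟨p, (Fact.out : p.Prime).pos, phi_translation_pow_char p h ω hp2 a b⟩

theorem orderOf_phi_translation (hp2 : p ≠ 2) {a b : K} (hab : a ≠ 0 ∨ b ≠ 0) :
    orderOf (phi (p ^ h) ω a b 1) = p :=
  orderOf_eq_prime (phi_translation_pow_char p h ω hp2 a b) fun e => by
    rw [phi_eq_one_iff] at e
    tauto

theorem orderOf_eq_of_orderOf_phi_eq (hp2 : p ≠ 2) {d : ℕ} (hd : d.Prime) (hpd : p ≠ d) {a b : K}
    {l : Kˣ} (hφ : orderOf (phi (p ^ h) ω a b l) = d) : orderOf l = d := by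
  have := Fact.mk hd
  apply orderOf_eq_prime
  · obtain ⟨a', b', e⟩ := exists_phi_pow_eq p h ω a b l d
    rw [← hφ, pow_orderOf_eq_one, hφ, eq_comm, phi_eq_one_iff] at e
    exact e.2.2
  · rintro rfl
    refine hpd ((Nat.prime_dvd_prime_iff_eq hd Fact.out).mp ?_).symm
    exact hφ ▸ orderOf_dvd_of_pow_eq_one (phi_translation_pow_char p h ω hp2 a b)

end Phi

section Form

variable {K : Type*} [Field K]

/-- The affine equation `y^q - y + ω x^{q+1} = 0` of the Hermitian curve. -/
def OnCurve (q : ℕ) (ω x y : K) : Prop := y ^ q - y + ω * x ^ (q + 1) = 0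

/-- The sesquilinear form with matrix `formMatrix ω`, semilinear in the first variable. -/
def form (q : ℕ) (ω : K) (u v : Fin 3 → K) : K :=
  ω * u 0 ^ q * v 0 + u 1 ^ q * v 2 - u 2 ^ q * v 1

/-- The projective Hermitian curve, as the set of isotropic points of `form q ω`. -/
def curvePoints (q : ℕ) (ω : K) : Set (ℙ K (Fin 3 → K)) := {P | form q ω P.rep P.rep = 0}

theorem mk_mem_curvePoints_iff {q : ℕ} {ω : K} {v : Fin 3 → K} (hv : v ≠ 0) :
    Projectivization.mk K v hv ∈ curvePoints q ω ↔ form q ω v v = 0 := by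
  obtain ⟨c, hc⟩ := Projectivization.exists_smul_eq_mk_rep K v hv
  have hform : form q ω (c • v) (c • v) = c ^ (q + 1) * form q ω v v := by
    simp only [form, Pi.smul_apply, Units.smul_def, smul_eq_mul]
    ring
  rw [curvePoints, Set.mem_ofPred_eq, ← hc, hform, mul_eq_zero,
    or_iff_right (pow_ne_zero _ c.ne_zero)]

/-- The point `(x : y : 1)`, which is the point `(x, y)` of the affine plane. -/
def affinePoint (x y : K) : ℙ K (Fin 3 → K) :=
  Projectivization.mk K ![x, y, 1] fun h => one_ne_zero (congrFun h 2)

theorem affinePoint_inj {x y x' y' : K} :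
    affinePoint x y = affinePoint x' y' ↔ x = x' ∧ y = y' := by
  refine ⟨fun e => ?_, by rintro ⟨rfl, rfl⟩; rfl⟩
  rw [affinePoint, affinePoint, Projectivization.mk_eq_mk_iff'] at e
  obtain ⟨c, hc⟩ := e
  have hc1 : c = 1 := by simpa using congrFun hc 2
  rw [hc1, one_smul] at hc
  exact ⟨(congrFun hc 0).symm, (congrFun hc 1).symm⟩

theorem affinePoint_mem_curvePoints_iff {q : ℕ} {ω x y : K} :
    affinePoint x y ∈ curvePoints q ω ↔ OnCurve q ω x y := by
  have hform : form q ω ![x, y, 1] ![x, y, 1] = y ^ q - y + ω * x ^ (q + 1) := by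
    simp only [form, Matrix.cons_val, one_pow]
    ring
  rw [affinePoint, mk_mem_curvePoints_iff, hform, OnCurve]

theorem onCurve_zero {q : ℕ} (hq : q ≠ 0) (ω : K) : OnCurve q ω 0 0 := by
  simp [OnCurve, hq]

theorem Yinf_mem_curvePoints {q : ℕ} (hq : q ≠ 0) {ω : K} : Yinf K ∈ curvePoints q ω := by
  rw [Yinf, mk_mem_curvePoints_iff]
  simp [form, hq]

theorem mk_eq_Yinf_iff {v : Fin 3 → K} (hv : v ≠ 0) :
    Projectivization.mk K v hv = Yinf K ↔ v 0 = 0 ∧ v 2 = 0 := by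
  rw [Yinf, Projectivization.mk_eq_mk_iff']
  constructor
  · rintro ⟨c, rfl⟩
    simp
  · rintro ⟨h0, h2⟩
    refine ⟨v 1, ?_⟩
    ext i
    fin_cases i <;> simp [h0, h2]

theorem affinePoint_ne_Yinf (x y : K) : affinePoint x y ≠ Yinf K := by
  rw [affinePoint, Ne, mk_eq_Yinf_iff]
  exact fun h => one_ne_zero h.2

theorem mk_eq_affinePoint {v : Fin 3 → K} (hv : v ≠ 0) (h2 : v 2 ≠ 0) :
    Projectivization.mk K v hv = affinePoint (v 0 / v 2) (v 1 / v 2) := by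
  rw [affinePoint, eq_comm, Projectivization.mk_eq_mk_iff']
  refine ⟨(v 2)⁻¹, ?_⟩
  ext i
  fin_cases i <;> simp [div_eq_inv_mul, h2]

theorem mk_eq_Yinf_of_form_eq_zero {q : ℕ} (hq : q ≠ 0) {ω : K} (hω0 : ω ≠ 0) {v : Fin 3 → K}
    (hv : v ≠ 0) (hform : form q ω v v = 0) (h2 : v 2 = 0) :
    Projectivization.mk K v hv = Yinf K := by
  refine (mk_eq_Yinf_iff hv).mpr ⟨?_, h2⟩
  simpa [form, h2, hq, hω0] using hform

theorem eq_Yinf_or_exists_affinePoint {q : ℕ} (hq : q ≠ 0) {ω : K} (hω0 : ω ≠ 0)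
    {P : ℙ K (Fin 3 → K)} (hP : P ∈ curvePoints q ω) :
    P = Yinf K ∨ ∃ x y, OnCurve q ω x y ∧ P = affinePoint x y := by
  induction P with | h v hv =>
  by_cases h2 : v 2 = 0
  · exact Or.inl (mk_eq_Yinf_of_form_eq_zero hq hω0 hv ((mk_mem_curvePoints_iff hv).mp hP) h2)
  · rw [mk_eq_affinePoint hv h2, affinePoint_mem_curvePoints_iff] at hP
    exact Or.inr ⟨_, _, hP, mk_eq_affinePoint hv h2⟩

theorem phi_smul_Yinf (q : ℕ) (ω a b : K) (l : Kˣ) : phi q ω a b l • Yinf K = Yinf K := by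
  rw [← mk_phiGL]
  nth_rw 1 [Yinf]
  rw [Projectivization.PGL.mk_smul_mk, mk_eq_Yinf_iff]
  change (phiGL q ω a b l).1.mulVec _ 0 = 0 ∧ (phiGL q ω a b l).1.mulVec _ 2 = 0
  rw [coe_phiGL]
  simp [Matrix.mulVec, dotProduct, Fin.sum_univ_three]

theorem phi_smul_affinePoint (q : ℕ) (ω a b x y : K) (l : Kˣ) :
    phi q ω a b l • affinePoint x y =
      affinePoint (l * x + a) (a ^ q * l * ω * x + l ^ (q + 1) * y + b) := by
  rw [← mk_phiGL, affinePoint, Projectivization.PGL.mk_smul_mk, affinePoint]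
  congr 1
  change (phiGL q ω a b l).1.mulVec _ = _
  rw [coe_phiGL]
  ext i
  fin_cases i <;> simp [Matrix.mulVec, dotProduct, Fin.sum_univ_three]

variable {p h : ℕ} [Fact p.Prime] {ω : K}

theorem pow_eq_neg (hω : ω ^ (p ^ h - 1) = -1) : ω ^ p ^ h = -ω := by
  have hq : p ^ h ≠ 0 := pow_ne_zero _ (Fact.out : p.Prime).ne_zero
  rw [← pow_sub_one_mul hq, hω, neg_one_mul]

variable [CharP K p]

theorem mem_GU_iff {A : GL (Fin 3) K} :
    A ∈ GU p h ω ↔ ((A : Matrix (Fin 3) (Fin 3) K).map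
      (iterateFrobenius K p h)).transpose * formMatrix ω * A = formMatrix ω := Iff.rfl

theorem form_eq_dotProduct (u v : Fin 3 → K) :
    form (p ^ h) ω u v = (iterateFrobenius K p h ∘ u) ⬝ᵥ (formMatrix ω).mulVec v := by
  simp only [form, formMatrix, dotProduct, Matrix.mulVec, Fin.sum_univ_three, Function.comp_apply,
    iterateFrobenius_def, Matrix.of_apply, Matrix.cons_val', Matrix.cons_val_fin_one,
    Matrix.cons_val]
  ring

theorem form_mulVec {A : GL (Fin 3) K} (hA : A ∈ GU p h ω) (u v : Fin 3 → K) :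
    form (p ^ h) ω (A.1.mulVec u) (A.1.mulVec v) = form (p ^ h) ω u v := by
  have e : iterateFrobenius K p h ∘ A.1.mulVec u =
      (A.1.map (iterateFrobenius K p h)).mulVec (iterateFrobenius K p h ∘ u) :=
    funext fun i => RingHom.map_mulVec _ _ _ i
  rw [form_eq_dotProduct, form_eq_dotProduct, e, Matrix.mulVec_mulVec,
    ← Matrix.vecMul_transpose, ← Matrix.dotProduct_mulVec, Matrix.mulVec_mulVec, ← mul_assoc,
    mem_GU_iff.mp hA]

theorem mem_GU_iff_form {A : GL (Fin 3) K} :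
    A ∈ GU p h ω ↔
      ∀ i j, form (p ^ h) ω (fun k => A.1 k i) (fun k => A.1 k j) = formMatrix ω i j := by
  rw [mem_GU_iff, ← Matrix.ext_iff]
  refine forall₂_congr fun i j => ?_
  rw [form_eq_dotProduct, mul_assoc, Matrix.mul_apply']
  rfl

theorem pow_eq_one_of_scalar_mem_GU {c : Kˣ}
    (hc : Matrix.GeneralLinearGroup.scalar (Fin 3) c ∈ GU p h ω) : c ^ (p ^ h + 1) = 1 := by
  have hp : p ≠ 0 := (Fact.out : p.Prime).ne_zero
  have := mem_GU_iff_form.mp hc 1 2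
  exact Units.ext (by simpa [form, formMatrix, hp, pow_succ] using this)

theorem smul_mem_curvePoints {g : PGL(3, K)} (hg : g ∈ PGU p h ω) {P : ℙ K (Fin 3 → K)}
    (hP : P ∈ curvePoints (p ^ h) ω) : g • P ∈ curvePoints (p ^ h) ω := by
  obtain ⟨A, hA, rfl⟩ := hg
  induction P with | h v hv =>
  rw [Projectivization.PGL.mk_smul_mk, mk_mem_curvePoints_iff]
  rw [mk_mem_curvePoints_iff, ← form_mulVec hA] at hP
  exact hP

theorem phi_mem_PGU (hF : ∀ x : K, (x ^ p ^ h) ^ p ^ h = x) (hω : ω ^ p ^ h = -ω) {a b : K}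
    (hab : OnCurve (p ^ h) ω a b) (l : Kˣ) : phi (p ^ h) ω a b l ∈ PGU p h ω := by
  have hp : p ≠ 0 := (Fact.out : p.Prime).ne_zero
  have hl : (l : K) ≠ 0 := l.ne_zero
  refine ⟨phiGL (p ^ h) ω a b l * Matrix.GeneralLinearGroup.scalar (Fin 3) l⁻¹, ?_, ?_⟩
  · have hM : (phiGL (p ^ h) ω a b l * Matrix.GeneralLinearGroup.scalar (Fin 3) l⁻¹).1 =
        !![1, 0, a / l; a ^ p ^ h * ω, (l : K) ^ p ^ h, b / l; 0, 0, 1 / l] := by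
      rw [coe_phiGL_mul_scalar]
      simp [pow_succ, div_eq_mul_inv, mul_right_comm _ (l : K)]
    rw [SetLike.mem_coe, mem_GU_iff_form, hM]
    unfold OnCurve at hab
    intro i j
    fin_cases i <;> fin_cases j <;> simp [form, formMatrix, hp, div_pow, mul_pow, hω, hF] <;>
      field_simp <;> first | linear_combination hab | ring
  · rw [map_mul, Matrix.ProjGenLinGroup.mk_scalar, mul_one, mk_phiGL]

theorem phi_mem_stabYinf (hF : ∀ x : K, (x ^ p ^ h) ^ p ^ h = x) (hω : ω ^ p ^ h = -ω) {a b : K}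
    (hab : OnCurve (p ^ h) ω a b) (l : Kˣ) : phi (p ^ h) ω a b l ∈ stabYinf p h ω :=
  ⟨phi_mem_PGU hF hω hab l, phi_smul_Yinf _ _ _ _ _⟩

theorem exists_eq_phi_diag_of_smul_eq (hω0 : ω ≠ 0) {g : PGL(3, K)} (hg : g ∈ PGU p h ω)
    (hY : g • Yinf K = Yinf K) (hO : g • affinePoint (0 : K) 0 = affinePoint 0 0) :
    ∃ l, g = phi (p ^ h) ω 0 0 l := by
  have hp : p ≠ 0 := (Fact.out : p.Prime).ne_zero
  obtain ⟨A, hA, rfl⟩ := hg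
  rw [Yinf, Projectivization.PGL.mk_smul_mk, Projectivization.mk_eq_mk_iff'] at hY
  rw [affinePoint, Projectivization.PGL.mk_smul_mk, Projectivization.mk_eq_mk_iff'] at hO
  obtain ⟨β, hβ⟩ := hY
  obtain ⟨γ, hγ⟩ := hO
  change _ = A.1.mulVec _ at hβ hγ
  have hA1 : ∀ i, A.1 i 1 = β * ![0, 1, 0] i := fun i => by
    simpa [Matrix.mulVec, dotProduct, Fin.sum_univ_three] using (congrFun hβ i).symm
  have hA2 : ∀ i, A.1 i 2 = γ * ![0, 0, 1] i := fun i => by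
    simpa [Matrix.mulVec, dotProduct, Fin.sum_univ_three] using (congrFun hγ i).symm
  replace hA := mem_GU_iff_form.mp hA
  have hγβ : γ ^ p ^ h * β = 1 := by simpa [form, formMatrix, hA1, hA2, hp] using hA 2 1
  have hβ0 : β ≠ 0 := right_ne_zero_of_mul_eq_one hγβ
  have hγ0 : γ ≠ 0 := ne_zero_pow (pow_ne_zero _ hp) (left_ne_zero_of_mul_eq_one hγβ)
  have h20 : A.1 2 0 = 0 := by simpa [form, formMatrix, hA1, hp, hβ0] using hA 1 0
  have h10 : A.1 1 0 = 0 := by simpa [form, formMatrix, hA2, hp, hγ0] using hA 2 0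
  have hα : A.1 0 0 ^ p ^ h * A.1 0 0 = 1 := by
    have h00 : ω * A.1 0 0 ^ p ^ h * A.1 0 0 = ω := by
      simpa [form, formMatrix, h10, h20, hp] using hA 0 0
    exact mul_left_cancel₀ hω0 (by linear_combination h00)
  have hβ_eq : (A.1 0 0 / γ) ^ (p ^ h + 1) * γ = β := by
    rw [div_pow, pow_succ, pow_succ, hα]
    field_simp
    linear_combination -hγβ
  refine ⟨Units.mk0 _ (right_ne_zero_of_mul_eq_one hα) / Units.mk0 γ hγ0, ?_⟩
  rw [← mk_phiGL, eq_comm, Matrix.ProjGenLinGroup.mk_eq_mk_iff]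
  refine ⟨Units.mk0 γ hγ0, Units.ext ?_⟩
  refine Eq.trans ?_ (Matrix.eta_fin_three A.1).symm
  rw [coe_phiGL_mul_scalar]
  simp [hA1, hA2, h10, h20, hγ0, hp, hβ_eq]

theorem exists_eq_phi_of_mem_stabYinf (hF : ∀ x : K, (x ^ p ^ h) ^ p ^ h = x)
    (hω : ω ^ p ^ h = -ω) (hω0 : ω ≠ 0) {g : PGL(3, K)} (hg : g ∈ stabYinf p h ω) :
    ∃ a b l, OnCurve (p ^ h) ω a b ∧ g = phi (p ^ h) ω a b l := by
  have hq : p ^ h ≠ 0 := pow_ne_zero _ (Fact.out : p.Prime).ne_zero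
  obtain ⟨hgU, hgY : g • Yinf K = Yinf K⟩ := hg
  obtain hgO | ⟨a, b, hab, hgO⟩ := eq_Yinf_or_exists_affinePoint hq hω0
    (smul_mem_curvePoints hgU (affinePoint_mem_curvePoints_iff.mpr (onCurve_zero hq ω)))
  · exact absurd (smul_left_cancel g (hgO.trans hgY.symm)) (affinePoint_ne_Yinf 0 0)
  have hφO : phi (p ^ h) ω a b 1 • affinePoint 0 0 = affinePoint a b := by
    simp [phi_smul_affinePoint]
  obtain ⟨l, hl⟩ := exists_eq_phi_diag_of_smul_eq hω0
    (mul_mem (inv_mem (phi_mem_PGU hF hω hab 1)) hgU)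
    (by rw [mul_smul, hgY, inv_smul_eq_iff, phi_smul_Yinf])
    (by rw [mul_smul, hgO, inv_smul_eq_iff, hφO])
  refine ⟨a, b, l, hab, ?_⟩
  rw [inv_mul_eq_iff_eq_mul.mp hl, phi_mul, phi_inj]
  simp

theorem onCurve_of_phi_mem_PGU {a b : K} {l : Kˣ} (hφ : phi (p ^ h) ω a b l ∈ PGU p h ω) :
    OnCurve (p ^ h) ω a b := by
  have hq : p ^ h ≠ 0 := pow_ne_zero _ (Fact.out : p.Prime).ne_zero
  simpa [phi_smul_affinePoint, affinePoint_mem_curvePoints_iff] using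
    smul_mem_curvePoints hφ (affinePoint_mem_curvePoints_iff.mpr (onCurve_zero hq ω))

/-- The isometry exchanging `(0 : 1 : 0)` and `(0 : 0 : 1)`. -/
def swapGL (K : Type*) [Field K] : GL (Fin 3) K :=
  Matrix.GeneralLinearGroup.mkOfDetNeZero !![1, 0, 0; 0, 0, 1; 0, -1, 0]
    (by simp [Matrix.det_fin_three])

theorem coe_swapGL : (swapGL K : Matrix (Fin 3) (Fin 3) K) = !![1, 0, 0; 0, 0, 1; 0, -1, 0] := rfl

theorem swapGL_mem_GU : swapGL K ∈ GU p h ω := by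
  have hp : p ≠ 0 := (Fact.out : p.Prime).ne_zero
  have hneg : (-1 : K) ^ p ^ h = -1 := by
    rw [← iterateFrobenius_def, map_neg, map_one]
  rw [mem_GU_iff_form, coe_swapGL]
  intro i j
  fin_cases i <;> fin_cases j <;> simp [form, formMatrix, hp, hneg]

omit [Fact p.Prime] [CharP K p] in
theorem swapGL_smul_affinePoint :
    Matrix.ProjGenLinGroup.mk (swapGL K) • affinePoint (0 : K) 0 = Yinf K := by
  rw [affinePoint, Projectivization.PGL.mk_smul_mk, mk_eq_Yinf_iff]
  change (swapGL K).1.mulVec _ 0 = 0 ∧ (swapGL K).1.mulVec _ 2 = 0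
  rw [coe_swapGL]
  simp [Matrix.mulVec, dotProduct, Fin.sum_univ_three]

theorem exists_smul_eq_Yinf (hF : ∀ x : K, (x ^ p ^ h) ^ p ^ h = x) (hω : ω ^ p ^ h = -ω)
    (hω0 : ω ≠ 0) {P : ℙ K (Fin 3 → K)} (hP : P ∈ curvePoints (p ^ h) ω) :
    ∃ g ∈ PGU p h ω, g • P = Yinf K := by
  have hq : p ^ h ≠ 0 := pow_ne_zero _ (Fact.out : p.Prime).ne_zero
  obtain rfl | ⟨x, y, hxy, rfl⟩ := eq_Yinf_or_exists_affinePoint hq hω0 hP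
  · exact ⟨1, one_mem _, one_smul _ _⟩
  · have hφ : phi (p ^ h) ω x y 1 • affinePoint 0 0 = affinePoint x y := by
      simp [phi_smul_affinePoint]
    refine ⟨Matrix.ProjGenLinGroup.mk (swapGL K) * (phi (p ^ h) ω x y 1)⁻¹,
      mul_mem ⟨_, swapGL_mem_GU, rfl⟩ (inv_mem (phi_mem_PGU hF hω hxy 1)), ?_⟩
    rw [mul_smul, inv_smul_eq_iff.mpr hφ.symm, swapGL_smul_affinePoint]

end Form

section NormalForm

open Matrix Matrix.ProjGenLinGroup

variable {K : Type*} [Field K] {p h : ℕ} [Fact p.Prime] [CharP K p] {ω : K}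

-- A representative has scalar `p`-th power; its power of exponent `p ^ h + 1` differs from it by a
-- scalar, and its `p`-th power is the norm of that scalar, which is `1`.
theorem exists_mem_GU_pow_eq_one (hh : h ≠ 0) {x : PGL(3, K)} (hx : x ∈ PGU p h ω)
    (hxp : x ^ p = 1) : ∃ X ∈ GU p h ω, mk X = x ∧ X ^ p = 1 := by
  obtain ⟨X, hX, rfl⟩ := hx
  rw [← map_pow, mk_eq_one, GeneralLinearGroup.center_eq_range_scalar] at hxp
  obtain ⟨c, hc⟩ := hxp
  have hc1 : c ^ (p ^ h + 1) = 1 :=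
    pow_eq_one_of_scalar_mem_GU (ω := ω) (hc ▸ pow_mem hX p)
  refine ⟨X ^ (p ^ h + 1), pow_mem hX _, ?_, ?_⟩
  · obtain ⟨k, rfl⟩ := Nat.exists_eq_succ_of_ne_zero hh
    rw [pow_succ X, map_mul, pow_succ', pow_mul, ← hc, ← map_pow, mk_scalar, one_mul]
  · rw [← pow_mul, mul_comm, pow_mul, ← hc, ← map_pow, hc1, map_one]

theorem form_mulVec_sub_one {X : GL (Fin 3) K} (hX : X ∈ GU p h ω) (u v : Fin 3 → K) :
    form (p ^ h) ω ((X.1 - 1) *ᵥ u) v = -form (p ^ h) ω (X.1 *ᵥ u) ((X.1 - 1) *ᵥ v) := by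
  have hleft : form (p ^ h) ω (X.1 *ᵥ u - u) v =
      form (p ^ h) ω (X.1 *ᵥ u) v - form (p ^ h) ω u v := by
    simp only [form, Pi.sub_apply, sub_pow_char_pow]
    ring
  have hright : form (p ^ h) ω (X.1 *ᵥ u) (X.1 *ᵥ v - v) =
      form (p ^ h) ω (X.1 *ᵥ u) (X.1 *ᵥ v) - form (p ^ h) ω (X.1 *ᵥ u) v := by
    simp only [form, Pi.sub_apply]
    ring
  rw [sub_mulVec, sub_mulVec, one_mulVec, one_mulVec, hleft, hright, form_mulVec hX]
  ring

theorem exists_mem_curvePoints_smul_eq (hh : h ≠ 0) {x : PGL(3, K)} (hx : x ∈ PGU p h ω)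
    (hxp : x ^ p = 1) (hx1 : x ≠ 1) : ∃ P ∈ curvePoints (p ^ h) ω, x • P = P := by
  obtain ⟨X, hX, rfl, hXp⟩ := exists_mem_GU_pow_eq_one hh hx hxp
  have hnil : IsNilpotent (toLin' (X.1 - 1)) := by
    refine ⟨p, ?_⟩
    rw [← toLin'_pow, sub_pow_char_of_commute _ (Commute.one_right _), ← Units.val_pow_eq_pow_val,
      hXp, Units.val_one, one_pow, sub_self, map_zero]
  have hne : toLin' (X.1 - 1) ≠ 0 := fun hzero => hx1 <| by
    have hX1 : X = 1 := Units.ext (sub_eq_zero.mp ((LinearEquiv.map_eq_zero_iff _).mp hzero))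
    rw [hX1, map_one]
  -- Vectors in both the image and the kernel of `X - 1` are isotropic.
  obtain ⟨w, hw0, hw⟩ := exists_apply_ne_zero_of_isNilpotent hnil hne
  simp only [toLin'_apply] at hw0 hw
  refine ⟨Projectivization.mk K _ hw0, ?_, ?_⟩
  · rw [mk_mem_curvePoints_iff, form_mulVec_sub_one hX, hw]
    simp [form]
  · rw [Projectivization.PGL.mk_smul_mk, Projectivization.mk_eq_mk_iff']
    rw [sub_mulVec, one_mulVec, sub_eq_zero] at hw
    exact ⟨1, (one_smul _ _).trans hw.symm⟩

omit [CharP K p] in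
theorem eq_Yinf_of_phi_translation_smul_eq (hω0 : ω ≠ 0) {a b : K}
    (hab : phi (p ^ h) ω a b 1 ≠ 1) {P : ℙ K (Fin 3 → K)} (hP : P ∈ curvePoints (p ^ h) ω)
    (hfix : phi (p ^ h) ω a b 1 • P = P) : P = Yinf K := by
  have hp : p ≠ 0 := (Fact.out : p.Prime).ne_zero
  obtain rfl | ⟨x, y, -, rfl⟩ := eq_Yinf_or_exists_affinePoint (pow_ne_zero h hp) hω0 hP
  · rfl
  refine absurd ((phi_eq_one_iff p h ω).mpr ?_) hab
  rw [phi_smul_affinePoint, affinePoint_inj] at hfix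
  have ha : a = 0 := by simpa using hfix.1
  exact ⟨ha, by simpa [ha, hp] using hfix.2, rfl⟩

theorem exists_eq_phi_translation (hF : ∀ x : K, (x ^ p ^ h) ^ p ^ h = x) (hω : ω ^ p ^ h = -ω)
    (hω0 : ω ≠ 0) {x : PGL(3, K)} (hx : x ∈ stabYinf p h ω) (hxp : x ^ p = 1) :
    ∃ a b, OnCurve (p ^ h) ω a b ∧ x = phi (p ^ h) ω a b 1 := by
  obtain ⟨a, b, l, hab, rfl⟩ := exists_eq_phi_of_mem_stabYinf hF hω hω0 hx
  obtain ⟨a', b', e⟩ := exists_phi_pow_eq p h ω a b l p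
  rw [hxp, eq_comm, phi_eq_one_iff] at e
  have hl : l = 1 := by
    refine Units.ext (frobenius_inj K p ?_)
    simpa [frobenius_def] using congrArg Units.val e.2.2
  exact ⟨a, b, hab, by rw [hl]⟩

theorem mem_stabYinf_of_mem_normalizer (hF : ∀ x : K, (x ^ p ^ h) ^ p ^ h = x)
    (hω : ω ^ p ^ h = -ω) (hω0 : ω ≠ 0) {x y : PGL(3, K)} (hx : x ∈ stabYinf p h ω)
    (hxp : x ^ p = 1) (hx1 : x ≠ 1) (hy : y ∈ PGU p h ω)
    (hyx : y ∈ Subgroup.normalizer (Subgroup.zpowers x : Set PGL(3, K))) :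
    y ∈ stabYinf p h ω := by
  have hq : p ^ h ≠ 0 := pow_ne_zero _ (Fact.out : p.Prime).ne_zero
  have hfix := smul_eq_of_mem_normalizer_zpowers hyx hx.2
  obtain ⟨a, b, -, rfl⟩ := exists_eq_phi_translation hF hω hω0 hx hxp
  exact ⟨hy, eq_Yinf_of_phi_translation_smul_eq hω0 hx1
    (smul_mem_curvePoints hy (Yinf_mem_curvePoints hq)) hfix⟩

theorem onCurve_norm_half (hF : ∀ x : K, (x ^ p ^ h) ^ p ^ h = x) (hω : ω ^ p ^ h = -ω)
    (h2 : (2 : K) ≠ 0) (s : K) : OnCurve (p ^ h) ω s (ω * s ^ (p ^ h + 1) / 2) := by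
  have h2q : (2 : K) ^ p ^ h = 2 := by rw [← iterateFrobenius_def, map_ofNat]
  rw [OnCurve, div_pow, mul_pow, hω, pow_succ, mul_pow, hF, h2q]
  field_simp
  ring

theorem exists_conj_eq_phi_vertical (hF : ∀ x : K, (x ^ p ^ h) ^ p ^ h = x)
    (hω : ω ^ p ^ h = -ω) (h2 : (2 : K) ≠ 0) (a b : K) {l : Kˣ} (hl : l ≠ 1) :
    ∃ g ∈ stabYinf p h ω, ∃ b', g * phi (p ^ h) ω a b l * g⁻¹ = phi (p ^ h) ω 0 b' l := by
  have hl1 : (l : K) - 1 ≠ 0 := sub_ne_zero.mpr (Units.val_eq_one.not.mpr hl)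
  set s : K := a / (l - 1) with hs
  refine ⟨_, phi_mem_stabYinf hF hω (onCurve_norm_half hF hω h2 s) 1, ?_⟩
  have hs0 : a + s - l * s = 0 := by
    rw [hs]
    field_simp
    ring
  rw [← hs0]
  exact exists_phi_translation_conj_eq p h ω s _ a b l

theorem exists_conj_phi_vertical_eq_phi_diag (hF : ∀ x : K, (x ^ p ^ h) ^ p ^ h = x)
    (hω : ω ^ p ^ h = -ω) {d : ℕ} (hd : (d : K) ≠ 0) {b : K} {l : Kˣ}
    (hb : OnCurve (p ^ h) ω 0 b) (hφ : phi (p ^ h) ω 0 b l ^ d = 1) :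
    ∃ g ∈ stabYinf p h ω, g * phi (p ^ h) ω 0 b l * g⁻¹ = phi (p ^ h) ω 0 0 l := by
  by_cases hn : (l : K) ^ (p ^ h + 1) = 1
  · rw [phi_vertical_pow p h ω b hn, phi_eq_one_iff] at hφ
    have hb0 : b = 0 := (mul_eq_zero.mp hφ.2.1).resolve_left hd
    exact ⟨1, one_mem _, by rw [hb0, one_mul, inv_one, mul_one]⟩
  · have hn0 : (l : K) ^ (p ^ h + 1) - 1 ≠ 0 := sub_ne_zero.mpr hn
    have hbq : b ^ p ^ h = b := by simpa [OnCurve, sub_eq_zero] using hb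
    set t : K := b / (l ^ (p ^ h + 1) - 1) with ht
    have htq : OnCurve (p ^ h) ω 0 t := by
      rw [OnCurve, ht, div_pow, sub_pow_char_pow, hbq, one_pow, pow_succ, mul_pow, hF,
        mul_comm (l : K)]
      simp
    refine ⟨_, phi_mem_stabYinf hF hω htq 1, ?_⟩
    rw [phi_vertical_conj, phi_inj, ht]
    refine ⟨rfl, ?_, rfl⟩
    field_simp
    ring

theorem exists_conj_eq_phi_diag (hF : ∀ x : K, (x ^ p ^ h) ^ p ^ h = x) (hω : ω ^ p ^ h = -ω)
    (hω0 : ω ≠ 0) (hp2 : p ≠ 2) {d : ℕ} (hd : d.Prime) (hpd : p ≠ d) {y : PGL(3, K)}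
    (hy : y ∈ stabYinf p h ω) (hyd : orderOf y = d) :
    ∃ g ∈ stabYinf p h ω, ∃ l : Kˣ, orderOf l = d ∧ g * y * g⁻¹ = phi (p ^ h) ω 0 0 l := by
  obtain ⟨a, b, l, -, rfl⟩ := exists_eq_phi_of_mem_stabYinf hF hω hω0 hy
  have hl : orderOf l = d := orderOf_eq_of_orderOf_phi_eq p h ω hp2 hd hpd hyd
  have hl1 : l ≠ 1 := orderOf_eq_one_iff.not.mp (hl ▸ hd.one_lt.ne')
  have h2 : (2 : K) ≠ 0 := Ring.two_ne_zero (ringChar.eq K p ▸ hp2)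
  obtain ⟨g, hg, b', hgb'⟩ := exists_conj_eq_phi_vertical hF hω h2 a b hl1
  have hb' : OnCurve (p ^ h) ω 0 b' := onCurve_of_phi_mem_PGU (l := l)
    (hgb' ▸ mul_mem (mul_mem hg.1 hy.1) (inv_mem hg.1))
  have hpow : phi (p ^ h) ω 0 b' l ^ d = 1 := by
    rw [← hgb', conj_pow, ← hyd, pow_orderOf_eq_one, mul_one, mul_inv_cancel]
  obtain ⟨g', hg', hg'b'⟩ := exists_conj_phi_vertical_eq_phi_diag hF hω
    (CharP.cast_ne_zero_of_ne_of_prime K hd hpd) hb' hpow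
  refine ⟨g' * g, mul_mem hg' hg, l, hl, ?_⟩
  rw [← hg'b', ← hgb']
  group

theorem exists_conjugateIn_zpowers_phi_sup (hF : ∀ x : K, (x ^ p ^ h) ^ p ^ h = x)
    (hω : ω ^ p ^ h = -ω) (hω0 : ω ≠ 0) (hh : h ≠ 0) (hp3 : 3 < p) {d : ℕ} (hd : d.Prime)
    (hpd : p ≠ d) {H : Subgroup PGL(3, K)} (hHle : H ≤ PGU p h ω) (hH : Nat.card H = d * p) :
    ∃ (a b : K) (l : Kˣ), orderOf l = d ∧ (a ≠ 0 ∨ b ≠ 0) ∧ OnCurve (p ^ h) ω a b ∧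
      phi (p ^ h) ω 0 0 l ∈
        Subgroup.normalizer (Subgroup.zpowers (phi (p ^ h) ω a b 1) : Set PGL(3, K)) ∧
      ConjugateIn (PGU p h ω) H
        (Subgroup.zpowers (phi (p ^ h) ω a b 1) ⊔ Subgroup.zpowers (phi (p ^ h) ω 0 0 l)) := by
  have hp : p.Prime := Fact.out
  obtain ⟨x, y, hxp, hyd, rfl, hyx⟩ := exists_zpowers_sup_eq_of_card_eq hp
    (by rwa [Fintype.card_fin]) hd (CharP.cast_ne_zero_of_ne_of_prime K hd hpd) hpd hH
  rw [sup_le_iff, Subgroup.zpowers_le, Subgroup.zpowers_le] at hHle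
  have hx1 : x ≠ 1 := orderOf_eq_one_iff.not.mp (hxp ▸ hp.one_lt.ne')
  have hxpow : x ^ p = 1 := hxp ▸ pow_orderOf_eq_one x
  obtain ⟨P, hP, hxP⟩ := exists_mem_curvePoints_smul_eq hh hHle.1 hxpow hx1
  obtain ⟨g, hg, hgP⟩ := exists_smul_eq_Yinf hF hω hω0 hP
  have conj_pow_eq_one (g : PGL(3, K)) : (g * x * g⁻¹) ^ p = 1 := by
    rw [conj_pow, hxpow, mul_one, mul_inv_cancel]
  have hgx : g * x * g⁻¹ ∈ stabYinf p h ω := by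
    refine ⟨(PGU p h ω).mul_mem (mul_mem hg hHle.1) (inv_mem hg), ?_⟩
    change (g * x * g⁻¹) • Yinf K = Yinf K
    rw [mul_smul, mul_smul, inv_smul_eq_iff.mpr hgP.symm, hxP, hgP]
  have hgy : g * y * g⁻¹ ∈ stabYinf p h ω :=
    mem_stabYinf_of_mem_normalizer hF hω hω0 hgx (conj_pow_eq_one g) (conj_eq_one_iff.not.mpr hx1)
      (mul_mem (mul_mem hg hHle.2) (inv_mem hg)) (conj_mem_normalizer_zpowers hyx g)
  obtain ⟨g', hg', l, hl, hφl⟩ := exists_conj_eq_phi_diag hF hω hω0 (by omega) hd hpd hgy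
    ((SemiconjBy.conj_mk g y).orderOf_eq.symm.trans hyd)
  have conj_conj (z : PGL(3, K)) : g' * (g * z * g⁻¹) * g'⁻¹ = g' * g * z * (g' * g)⁻¹ := by group
  have hgx' := mul_mem (mul_mem hg' hgx) (inv_mem hg')
  rw [conj_conj] at hφl hgx'
  obtain ⟨a, b, hab, hφ⟩ := exists_eq_phi_translation hF hω hω0 hgx' (conj_pow_eq_one _)
  refine ⟨a, b, l, hl, ?_, hab, ?_, g' * g, mul_mem hg'.1 hg, ?_⟩
  · by_contra! h0
    rw [h0.1, h0.2, phi_one, conj_eq_one_iff] at hφ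
    exact hx1 hφ
  · rw [← hφ, ← hφl]
    exact conj_mem_normalizer_zpowers hyx (g' * g)
  · rw [map_conj_zpowers_sup, hφ, hφl]

end NormalForm

section Normalizer

variable {K : Type*} [Field K] (p h : ℕ) [Fact p.Prime] [CharP K p] (ω : K)

theorem sigmaDiag_congr {l l' : Kˣ} (hl : IsOfFinOrder l) (hll' : orderOf l = orderOf l') :
    sigmaDiag (p ^ h) ω l = sigmaDiag (p ^ h) ω l' := by
  have : NeZero (orderOf l) := ⟨hl.orderOf_pos.ne'⟩
  have hl' : IsPrimitiveRoot l' (orderOf l) := hll' ▸ IsPrimitiveRoot.orderOf l'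
  rw [sigmaDiag_eq_map, sigmaDiag_eq_map, (IsPrimitiveRoot.orderOf l).zpowers_eq, hl'.zpowers_eq]

theorem phi_diag_mem_normalizer_iff (hp2 : p ≠ 2) (a b : K) (l : Kˣ) :
    phi (p ^ h) ω 0 0 l ∈
        Subgroup.normalizer (Subgroup.zpowers (phi (p ^ h) ω a b 1) : Set PGL(3, K)) ↔
      ∃ k : ℕ, l * a = k * a ∧
        (l : K) ^ (p ^ h + 1) * b = k * b + (k.choose 2 : K) * (ω * a ^ (p ^ h + 1)) := by
  simp only [mem_normalizer_zpowers_iff (isOfFinOrder_phi_translation p h ω hp2 a b),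
    phi_diag_conj, phi_translation_pow, phi_inj, and_true]

theorem phi_diag_mem_normalizer_vertical_iff (hp2 : p ≠ 2) {b : K} (hb : b ≠ 0) {l : Kˣ} :
    phi (p ^ h) ω 0 0 l ∈
        Subgroup.normalizer (Subgroup.zpowers (phi (p ^ h) ω 0 b 1) : Set PGL(3, K)) ↔
      orderOf l ∣ (p ^ h + 1) * (p - 1) := by
  rw [phi_diag_mem_normalizer_iff p h ω hp2, orderOf_dvd_iff_pow_eq_one, pow_mul,
    ← orderOf_dvd_iff_pow_eq_one, ← exists_natCast_eq_iff p]
  simp [hb]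

theorem phi_diag_mem_normalizer_iff_of_ne_zero (hp2 : p ≠ 2) {a b : K} (ha : a ≠ 0) {l : Kˣ}
    (hl : l ≠ 1) :
    phi (p ^ h) ω 0 0 l ∈
        Subgroup.normalizer (Subgroup.zpowers (phi (p ^ h) ω a b 1) : Set PGL(3, K)) ↔
      orderOf l ∣ p - 1 ∧ b = ω * a ^ (p ^ h + 1) / 2 := by
  have h2 : NeZero (2 : K) := ⟨Ring.two_ne_zero (ringChar.eq K p ▸ hp2)⟩
  have hl1 : (l : K) - 1 ≠ 0 := sub_ne_zero.mpr (Units.val_eq_one.not.mpr hl)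
  have coeff_iff {k : ℕ} (hk : (l : K) = k) :
      (l : K) ^ (p ^ h + 1) * b = k * b + (k.choose 2 : K) * (ω * a ^ (p ^ h + 1)) ↔
        b = ω * a ^ (p ^ h + 1) / 2 := by
    have hlq : (l : K) ^ p ^ h = l :=
      pow_pow_eq_self_of_orderOf_dvd p h ((exists_natCast_eq_iff p).mp ⟨k, hk⟩)
    rw [Nat.cast_choose_two, ← hk, pow_succ (l : K), hlq]
    refine ⟨fun e => mul_left_cancel₀ (mul_ne_zero l.ne_zero hl1) ?_, fun e => ?_⟩
    · linear_combination e
    · linear_combination (l : K) * (l - 1) * e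
  rw [phi_diag_mem_normalizer_iff p h ω hp2, ← exists_natCast_eq_iff p, ← exists_and_right]
  refine exists_congr fun k => ?_
  rw [mul_left_inj' ha]
  exact and_congr_right coeff_iff

theorem commute_phi_diag_iff {a b : K} {l : Kˣ} :
    Commute (phi (p ^ h) ω a b 1) (phi (p ^ h) ω 0 0 l) ↔
      l * a = a ∧ (l : K) ^ (p ^ h + 1) * b = b := by
  rw [commute_iff_eq, eq_comm, ← mul_inv_eq_iff_eq_mul, phi_diag_conj, phi_inj,
    and_iff_left rfl]

end Normalizer

section Representatives

variable {K : Type*} [Field K] {p h : ℕ} [Fact p.Prime] [CharP K p] {ω : K}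

theorem conjugateIn_phi_diag (hF : ∀ x : K, (x ^ p ^ h) ^ p ^ h = x) (hω : ω ^ p ^ h = -ω)
    (a b : K) (l m : Kˣ) :
    ConjugateIn (PGU p h ω)
      (Subgroup.zpowers (phi (p ^ h) ω a b 1) ⊔ Subgroup.zpowers (phi (p ^ h) ω 0 0 l))
      (Subgroup.zpowers (phi (p ^ h) ω (m * a) (m ^ (p ^ h + 1) * b) 1) ⊔
        Subgroup.zpowers (phi (p ^ h) ω 0 0 l)) := by
  have hq : p ^ h ≠ 0 := pow_ne_zero _ (Fact.out : p.Prime).ne_zero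
  refine ⟨phi (p ^ h) ω 0 0 m, phi_mem_PGU hF hω (onCurve_zero hq ω) m, ?_⟩
  rw [map_conj_zpowers_sup, phi_diag_conj, phi_diag_conj, mul_zero, mul_zero]

theorem conjugateIn_centralGroup [Finite K] (hK : Nat.card K = (p ^ h) ^ 2)
    (hF : ∀ x : K, (x ^ p ^ h) ^ p ^ h = x) (hω : ω ^ p ^ h = -ω) {b : K} (hb0 : b ≠ 0)
    (hb : OnCurve (p ^ h) ω 0 b) (l : Kˣ) :
    ConjugateIn (PGU p h ω)
      (Subgroup.zpowers (phi (p ^ h) ω 0 b 1) ⊔ Subgroup.zpowers (phi (p ^ h) ω 0 0 l))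
      (centralGroup (p ^ h) ω l) := by
  have hbq : b ^ p ^ h = b := by simpa [OnCurve, sub_eq_zero] using hb
  obtain ⟨m, hm⟩ := exists_pow_succ_eq hK (inv_ne_zero hb0) (by rw [inv_pow, hbq])
  have hconj := conjugateIn_phi_diag hF hω 0 b l m
  rwa [mul_zero, hm, inv_mul_cancel₀ hb0] at hconj

theorem conjugateIn_noncentralGroup (hF : ∀ x : K, (x ^ p ^ h) ^ p ^ h = x)
    (hω : ω ^ p ^ h = -ω) {a : K} (ha : a ≠ 0) (l : Kˣ) :
    ConjugateIn (PGU p h ω)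
      (Subgroup.zpowers (phi (p ^ h) ω a (ω * a ^ (p ^ h + 1) / 2) 1) ⊔
        Subgroup.zpowers (phi (p ^ h) ω 0 0 l))
      (noncentralGroup (p ^ h) ω l) := by
  have hconj := conjugateIn_phi_diag hF hω a (ω * a ^ (p ^ h + 1) / 2) l (Units.mk0 a ha)⁻¹
  have ha1 : ((Units.mk0 a ha)⁻¹ : Kˣ) * a = (1 : K) := by
    rw [Units.val_inv_eq_inv_val, Units.val_mk0, inv_mul_cancel₀ ha]
  have hb1 : (((Units.mk0 a ha)⁻¹ : Kˣ) : K) ^ (p ^ h + 1) * (ω * a ^ (p ^ h + 1) / 2) = ω / 2 := by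
    rw [mul_div_assoc', mul_left_comm, ← mul_pow, ha1, one_pow, mul_one]
  rwa [ha1, hb1] at hconj

theorem exists_orderOf_eq_and_conjugateIn [Finite K] (hK : Nat.card K = (p ^ h) ^ 2) (hh : h ≠ 0)
    (hF : ∀ x : K, (x ^ p ^ h) ^ p ^ h = x) (hω : ω ^ p ^ h = -ω) (hω0 : ω ≠ 0) (hp3 : 3 < p)
    {d : ℕ} (hd : d.Prime) (hpd : p ≠ d) {H : Subgroup PGL(3, K)} (hHle : H ≤ PGU p h ω)
    (hH : Nat.card H = d * p) :
    (∃ l : Kˣ, orderOf l = d) ∧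
      ∀ l : Kˣ, orderOf l = d →
        (d ∣ p ^ h + 1 ∧ ConjugateIn (PGU p h ω) H (centralGroup (p ^ h) ω l)) ∨
        (d ∣ p - 1 ∧ ConjugateIn (PGU p h ω) H (centralGroup (p ^ h) ω l)) ∨
        (d ∣ p - 1 ∧ ConjugateIn (PGU p h ω) H (noncentralGroup (p ^ h) ω l)) := by
  have hp2 : p ≠ 2 := by omega
  obtain ⟨a, b, l₀, hl₀, hab0, hab, hnorm, hconj⟩ :=
    exists_conjugateIn_zpowers_phi_sup hF hω hω0 hh hp3 hd hpd hHle hH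
  refine ⟨⟨l₀, hl₀⟩, fun l hl => ?_⟩
  have hdiag : sigmaDiag (p ^ h) ω l₀ = sigmaDiag (p ^ h) ω l :=
    sigmaDiag_congr p h ω (orderOf_pos_iff.mp (hl₀ ▸ hd.pos)) (hl₀.trans hl.symm)
  rw [sigmaDiag, sigmaDiag] at hdiag
  rw [hdiag] at hconj
  by_cases ha : a = 0
  · subst ha
    have hb : b ≠ 0 := hab0.resolve_left (not_not_intro rfl)
    rw [phi_diag_mem_normalizer_vertical_iff p h ω hp2 hb, hl₀, hd.dvd_mul] at hnorm
    have hcentral := hconj.trans (conjugateIn_centralGroup hK hF hω hb hab l)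
    exact hnorm.imp (⟨·, hcentral⟩) fun hdvd => Or.inl ⟨hdvd, hcentral⟩
  · have hl1 : l₀ ≠ 1 := orderOf_eq_one_iff.not.mp (hl₀ ▸ hd.one_lt.ne')
    rw [phi_diag_mem_normalizer_iff_of_ne_zero p h ω hp2 ha hl1, hl₀] at hnorm
    obtain ⟨hdvd, rfl⟩ := hnorm
    exact Or.inr (Or.inr ⟨hdvd, hconj.trans (conjugateIn_noncentralGroup hF hω ha l)⟩)

end Representatives

section Structure

variable {K : Type*} [Field K] {p h : ℕ} [Fact p.Prime] [CharP K p] {ω : K}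

theorem card_sigmaCentral (hp2 : p ≠ 2) : Nat.card (sigmaCentral (p ^ h) ω) = p := by
  rw [sigmaCentral, Nat.card_zpowers, orderOf_phi_translation p h ω hp2 (Or.inr one_ne_zero)]

theorem card_sigmaNoncentral (hp2 : p ≠ 2) : Nat.card (sigmaNoncentral (p ^ h) ω) = p := by
  rw [sigmaNoncentral, Nat.card_zpowers, orderOf_phi_translation p h ω hp2 (Or.inl one_ne_zero)]

theorem card_sigmaDiag (l : Kˣ) : Nat.card (sigmaDiag (p ^ h) ω l) = orderOf l := by
  rw [sigmaDiag, Nat.card_zpowers, orderOf_phi_diag]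

theorem zpowers_phi_le_stabYinf (hF : ∀ x : K, (x ^ p ^ h) ^ p ^ h = x) (hω : ω ^ p ^ h = -ω)
    {a b : K} (hab : OnCurve (p ^ h) ω a b) (l : Kˣ) :
    Subgroup.zpowers (phi (p ^ h) ω a b l) ≤ stabYinf p h ω :=
  Subgroup.zpowers_le.mpr (phi_mem_stabYinf hF hω hab l)

theorem sigmaDiag_le_stabYinf (hF : ∀ x : K, (x ^ p ^ h) ^ p ^ h = x) (hω : ω ^ p ^ h = -ω)
    (l : Kˣ) : sigmaDiag (p ^ h) ω l ≤ stabYinf p h ω :=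
  zpowers_phi_le_stabYinf hF hω (onCurve_zero (pow_ne_zero _ (Fact.out : p.Prime).ne_zero) ω) l

theorem centralGroup_le_stabYinf (hF : ∀ x : K, (x ^ p ^ h) ^ p ^ h = x) (hω : ω ^ p ^ h = -ω)
    (l : Kˣ) : centralGroup (p ^ h) ω l ≤ stabYinf p h ω := by
  have hp : p ≠ 0 := (Fact.out : p.Prime).ne_zero
  have honCurve : OnCurve (p ^ h) ω 0 1 := by simp [OnCurve, hp]
  exact sup_le (zpowers_phi_le_stabYinf hF hω honCurve 1) (sigmaDiag_le_stabYinf hF hω l)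

theorem noncentralGroup_le_stabYinf (hF : ∀ x : K, (x ^ p ^ h) ^ p ^ h = x)
    (hω : ω ^ p ^ h = -ω) (hp2 : p ≠ 2) (l : Kˣ) :
    noncentralGroup (p ^ h) ω l ≤ stabYinf p h ω := by
  have honCurve := onCurve_norm_half hF hω (Ring.two_ne_zero (ringChar.eq K p ▸ hp2)) 1
  rw [one_pow, mul_one] at honCurve
  exact sup_le (zpowers_phi_le_stabYinf hF hω honCurve 1) (sigmaDiag_le_stabYinf hF hω l)

theorem disjoint_zpowers_phi_translation_sigmaDiag (hp2 : p ≠ 2) (a b : K) (l : Kˣ) :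
    Disjoint (Subgroup.zpowers (phi (p ^ h) ω a b 1)) (sigmaDiag (p ^ h) ω l) := by
  rw [Subgroup.disjoint_def]
  intro x hx hxl
  obtain ⟨k, rfl⟩ := (isOfFinOrder_phi_translation p h ω hp2 a b).mem_powers_iff_mem_zpowers.mpr hx
  rw [sigmaDiag_eq_map] at hxl
  obtain ⟨m, -, hm⟩ := hxl
  change _ = phi (p ^ h) ω a b 1 ^ k at hm
  change phi (p ^ h) ω a b 1 ^ k = 1
  have hm1 : m = 1 := by
    rw [phi_translation_pow, phiDiagHom_apply, phi_inj] at hm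
    exact hm.2.2
  rw [← hm, hm1, map_one]

theorem isInternalSemidirect_centralGroup (hp2 : p ≠ 2) {l : Kˣ}
    (hl : orderOf l ∣ (p ^ h + 1) * (p - 1)) :
    IsInternalSemidirect (centralGroup (p ^ h) ω l) (sigmaCentral (p ^ h) ω)
      (sigmaDiag (p ^ h) ω l) :=
  isInternalSemidirect_sup
    (Subgroup.zpowers_le.mpr
      ((phi_diag_mem_normalizer_vertical_iff p h ω hp2 one_ne_zero).mpr hl))
    (disjoint_zpowers_phi_translation_sigmaDiag hp2 0 1 l)

theorem card_centralGroup (hp2 : p ≠ 2) {l : Kˣ} (hl : orderOf l ∣ (p ^ h + 1) * (p - 1)) :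
    Nat.card (centralGroup (p ^ h) ω l) = orderOf l * p := by
  rw [← (isInternalSemidirect_centralGroup hp2 hl).card_mul_card, card_sigmaCentral hp2,
    card_sigmaDiag, mul_comm]

theorem isInternalSemidirect_noncentralGroup (hp2 : p ≠ 2) {l : Kˣ} (hl1 : l ≠ 1)
    (hl : orderOf l ∣ p - 1) :
    IsInternalSemidirect (noncentralGroup (p ^ h) ω l) (sigmaNoncentral (p ^ h) ω)
      (sigmaDiag (p ^ h) ω l) :=
  isInternalSemidirect_sup
    (Subgroup.zpowers_le.mpr
      ((phi_diag_mem_normalizer_iff_of_ne_zero p h ω hp2 one_ne_zero hl1).mpr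
        ⟨hl, by rw [one_pow, mul_one]⟩))
    (disjoint_zpowers_phi_translation_sigmaDiag hp2 1 (ω / 2) l)

theorem card_noncentralGroup (hp2 : p ≠ 2) {l : Kˣ} (hl1 : l ≠ 1) (hl : orderOf l ∣ p - 1) :
    Nat.card (noncentralGroup (p ^ h) ω l) = orderOf l * p := by
  rw [← (isInternalSemidirect_noncentralGroup hp2 hl1 hl).card_mul_card,
    card_sigmaNoncentral hp2, card_sigmaDiag, mul_comm]

theorem commute_phi_vertical_phi_diag {l : Kˣ} (hl : orderOf l ∣ p ^ h + 1) (b : K) :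
    Commute (phi (p ^ h) ω 0 b 1) (phi (p ^ h) ω 0 0 l) := by
  have hl1 : (l : K) ^ (p ^ h + 1) = 1 := by
    rw [← Units.val_pow_eq_pow_val, orderOf_dvd_iff_pow_eq_one.mp hl, Units.val_one]
  exact (commute_phi_diag_iff p h ω).mpr ⟨mul_zero _, by rw [hl1, one_mul]⟩

theorem isInternalDirect_centralGroup (hp2 : p ≠ 2) {l : Kˣ} (hl : orderOf l ∣ p ^ h + 1) :
    IsInternalDirect (centralGroup (p ^ h) ω l) (sigmaCentral (p ^ h) ω)
      (sigmaDiag (p ^ h) ω l) :=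
  isInternalDirect_sup_of_le_centralizer
    (zpowers_le_centralizer_zpowers_iff.mpr (commute_phi_vertical_phi_diag hl 1))
    (disjoint_zpowers_phi_translation_sigmaDiag hp2 0 1 l)

theorem isCyclic_centralGroup (hp2 : p ≠ 2) {l : Kˣ} (hl : orderOf l ∣ p ^ h + 1) :
    IsCyclic (centralGroup (p ^ h) ω l) := by
  have hp : p.Prime := Fact.out
  have hlp : p.Coprime (orderOf l) := by
    refine Nat.Coprime.coprime_dvd_right hl ?_
    cases h with
    | zero => exact (Nat.coprime_primes hp Nat.prime_two).mpr hp2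
    | succ h => simp [pow_succ]
  have hcard : Nat.card (centralGroup (p ^ h) ω l) ≠ 0 := by
    rw [card_centralGroup hp2 (hl.mul_right _)]
    exact mul_ne_zero (ne_zero_of_dvd_ne_zero (Nat.succ_ne_zero _) hl) hp.ne_zero
  have : Finite (centralGroup (p ^ h) ω l) := Nat.finite_of_card_ne_zero hcard
  refine (isInternalDirect_centralGroup hp2 hl).1.isCyclic_of_commute
    (commute_phi_vertical_phi_diag hl 1) ?_
  rwa [orderOf_phi_translation p h ω hp2 (Or.inr one_ne_zero), orderOf_phi_diag]

theorem centralGroup_not_commutative {l : Kˣ} (hl : orderOf l ∣ p - 1) (hl2 : l ^ 2 ≠ 1) :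
    ¬ ∀ x ∈ centralGroup (p ^ h) ω l, ∀ y ∈ centralGroup (p ^ h) ω l, x * y = y * x := by
  intro hcomm
  have h1 := ((commute_phi_diag_iff p h ω).mp (hcomm _
    (Subgroup.mem_sup_left (Subgroup.mem_zpowers (phi (p ^ h) ω 0 1 1))) _
    (Subgroup.mem_sup_right (Subgroup.mem_zpowers (phi (p ^ h) ω 0 0 l))))).2
  rw [mul_one, pow_succ, pow_pow_eq_self_of_orderOf_dvd p h hl, ← pow_two,
    ← Units.val_pow_eq_pow_val, Units.val_eq_one] at h1
  exact hl2 h1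

theorem noncentralGroup_not_commutative {l : Kˣ} (hl1 : l ≠ 1) :
    ¬ ∀ x ∈ noncentralGroup (p ^ h) ω l, ∀ y ∈ noncentralGroup (p ^ h) ω l, x * y = y * x := by
  intro hcomm
  have h1 := ((commute_phi_diag_iff p h ω).mp (hcomm _
    (Subgroup.mem_sup_left (Subgroup.mem_zpowers (phi (p ^ h) ω 1 (ω / 2) 1))) _
    (Subgroup.mem_sup_right (Subgroup.mem_zpowers (phi (p ^ h) ω 0 0 l))))).1
  rw [mul_one, Units.val_eq_one] at h1
  exact hl1 h1

end Structure

section Classification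

variable {K : Type*} [Field K] {p h : ℕ} [Fact p.Prime] [CharP K p] {ω : K}

theorem exists_finset_conjugateIn [Finite K] (hK : Nat.card K = (p ^ h) ^ 2) (hh : h ≠ 0)
    (hF : ∀ x : K, (x ^ p ^ h) ^ p ^ h = x) (hω : ω ^ p ^ h = -ω) (hω0 : ω ≠ 0) (hp3 : 3 < p)
    {d : ℕ} (hd : d.Prime) (hpd : p ≠ d) :
    ∃ S : Finset (Subgroup PGL(3, K)), S.card ≤ 2 ∧
      (∀ H ∈ S, H ≤ stabYinf p h ω ∧ Nat.card H = d * p) ∧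
      ∀ H : Subgroup PGL(3, K), H ≤ PGU p h ω → Nat.card H = d * p →
        ∃ H' ∈ S, ConjugateIn (PGU p h ω) H H' := by
  classical
  have classify := @exists_orderOf_eq_and_conjugateIn K _ p h _ _ ω _ hK hh hF hω hω0 hp3 d hd hpd
  by_cases hl : ∃ l : Kˣ, orderOf l = d
  · obtain ⟨l, hl⟩ := hl
    let S : Finset (Subgroup PGL(3, K)) := {centralGroup (p ^ h) ω l, noncentralGroup (p ^ h) ω l}
    refine ⟨S.filter fun H => Nat.card H = d * p,
      (Finset.card_filter_le _ _).trans Finset.card_le_two, fun H hHS => ?_, fun H hHle hH => ?_⟩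
    · obtain ⟨hHS, hH⟩ := Finset.mem_filter.mp hHS
      refine ⟨?_, hH⟩
      rcases Finset.mem_insert.mp hHS with rfl | hHS
      · exact centralGroup_le_stabYinf hF hω l
      · rw [Finset.mem_singleton.mp hHS]
        exact noncentralGroup_le_stabYinf hF hω (by omega) l
    · have : ∃ H' ∈ S, ConjugateIn (PGU p h ω) H H' := by
        have := (classify hHle hH).2 l hl
        simp only [S, Finset.mem_insert, Finset.mem_singleton, exists_eq_or_imp, exists_eq_left]
        tauto
      obtain ⟨H', hH'S, hconj⟩ := this
      exact ⟨H', Finset.mem_filter.mpr ⟨hH'S, hconj.card_eq.symm.trans hH⟩, hconj⟩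
  · exact ⟨∅, Nat.zero_le _, by simp, fun H hHle hH => absurd (classify hHle hH).1 hl⟩

end Classification

end Hermitian

open Hermitian in
theorem theorem2_general {K : Type*} [Field K] (p d h : ℕ) [Fact p.Prime] [CharP K p]
    (hd : d.Prime) (hp3 : 3 < p) (hd2 : d ≠ 2) (hpd : p ≠ d)
    (hK : Nat.card K = (p ^ h) ^ 2)
    (ω : K) (hω : ω ^ (p ^ h - 1) = -1) :
    (∃ S : Finset (Subgroup PGL(3, K)), S.card ≤ 2 ∧
      (∀ H ∈ S, H ≤ stabYinf p h ω ∧ Nat.card H = d * p) ∧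
      ∀ H : Subgroup PGL(3, K), H ≤ PGU p h ω → Nat.card H = d * p →
        ∃ H' ∈ S, ConjugateIn (PGU p h ω) H H') ∧
    (∀ H : Subgroup PGL(3, K), H ≤ PGU p h ω → Nat.card H = d * p →
      (∃ l : Kˣ, orderOf l = d) ∧
      ∀ l : Kˣ, orderOf l = d →
        (d ∣ p ^ h + 1 ∧
          ConjugateIn (PGU p h ω) H (centralGroup (p ^ h) ω l)) ∨
        (d ∣ p - 1 ∧
          ConjugateIn (PGU p h ω) H (centralGroup (p ^ h) ω l)) ∨
        (d ∣ p - 1 ∧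
          ConjugateIn (PGU p h ω) H (noncentralGroup (p ^ h) ω l))) ∧
    (∀ l : Kˣ, orderOf l = d →
      Nat.card (sigmaCentral (p ^ h) ω) = p ∧
      Nat.card (sigmaNoncentral (p ^ h) ω) = p ∧
      Nat.card (sigmaDiag (p ^ h) ω l) = d ∧
      (d ∣ p ^ h + 1 →
        centralGroup (p ^ h) ω l ≤ stabYinf p h ω ∧
        Nat.card (centralGroup (p ^ h) ω l) = d * p ∧
        IsInternalDirect (centralGroup (p ^ h) ω l)
          (sigmaCentral (p ^ h) ω) (sigmaDiag (p ^ h) ω l) ∧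
        IsCyclic (centralGroup (p ^ h) ω l)) ∧
      (d ∣ p - 1 →
        centralGroup (p ^ h) ω l ≤ stabYinf p h ω ∧
        Nat.card (centralGroup (p ^ h) ω l) = d * p ∧
        IsInternalSemidirect (centralGroup (p ^ h) ω l)
          (sigmaCentral (p ^ h) ω) (sigmaDiag (p ^ h) ω l) ∧
        ¬ ∀ x ∈ centralGroup (p ^ h) ω l,
            ∀ y ∈ centralGroup (p ^ h) ω l, x * y = y * x) ∧
      (d ∣ p - 1 →
        noncentralGroup (p ^ h) ω l ≤ stabYinf p h ω ∧
        Nat.card (noncentralGroup (p ^ h) ω l) = d * p ∧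
        IsInternalSemidirect (noncentralGroup (p ^ h) ω l)
          (sigmaNoncentral (p ^ h) ω) (sigmaDiag (p ^ h) ω l) ∧
        ¬ ∀ x ∈ noncentralGroup (p ^ h) ω l,
            ∀ y ∈ noncentralGroup (p ^ h) ω l, x * y = y * x)) := by
  have : Finite K := Nat.finite_of_card_ne_zero
    (hK ▸ pow_ne_zero 2 (pow_ne_zero h (Fact.out : p.Prime).ne_zero))
  have hp2 : p ≠ 2 := by omega
  have hh := exponent_ne_zero_of_card_eq hK
  have hF := pow_pow_eq_self_of_card_eq hK
  have hq1 : p ^ h - 1 ≠ 0 := Nat.sub_ne_zero_of_lt (Nat.one_lt_pow hh (Fact.out : p.Prime).one_lt)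
  have hω0 : ω ≠ 0 := ne_zero_pow hq1 (hω ▸ neg_ne_zero.mpr one_ne_zero)
  have hωq := pow_eq_neg hω
  refine ⟨exists_finset_conjugateIn hK hh hF hωq hω0 hp3 hd hpd, fun H hHle hH =>
    exists_orderOf_eq_and_conjugateIn hK hh hF hωq hω0 hp3 hd hpd hHle hH, ?_⟩
  rintro l rfl
  have hl1 : l ≠ 1 := fun e => hd.one_lt.ne' (orderOf_eq_one_iff.mpr e)
  have hl2 : l ^ 2 ≠ 1 := fun e =>
    hd2 ((Nat.prime_dvd_prime_iff_eq hd Nat.prime_two).mp (orderOf_dvd_of_pow_eq_one e))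
  refine ⟨card_sigmaCentral hp2, card_sigmaNoncentral hp2, card_sigmaDiag l,
    fun hdvd => ⟨centralGroup_le_stabYinf hF hωq l, card_centralGroup hp2 (hdvd.mul_right _),
      isInternalDirect_centralGroup hp2 hdvd, isCyclic_centralGroup hp2 hdvd⟩,
    fun hdvd => ⟨centralGroup_le_stabYinf hF hωq l, card_centralGroup hp2 (hdvd.mul_left _),
      isInternalSemidirect_centralGroup hp2 (hdvd.mul_left _),
      centralGroup_not_commutative hdvd hl2⟩,
    fun hdvd => ⟨noncentralGroup_le_stabYinf hF hωq hp2 l, card_noncentralGroup hp2 hl1 hdvd,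
      isInternalSemidirect_noncentralGroup hp2 hl1 hdvd, noncentralGroup_not_commutative hl1⟩⟩

theorem theorem2 {K : Type*} [Field K] [Finite K] (p d h : ℕ) [Fact p.Prime] [CharP K p]
    (hd : d.Prime) (hp3 : 3 < p) (hd3 : 3 < d) (hpd : p ≠ d)
    (hK : Nat.card K = (p ^ h) ^ 2)
    (ω : K) (hω : ω ^ (p ^ h - 1) = -1) :
    -- up to conjugacy, at most three subgroups of order `d * p`, inside the stabiliser of `Y_∞`
    (∃ S : Finset (Subgroup PGL(3, K)), S.card ≤ 3 ∧
      (∀ H ∈ S, H ≤ Hermitian.stabYinf p h ω ∧ Nat.card H = d * p) ∧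
      ∀ H : Subgroup PGL(3, K), H ≤ Hermitian.PGU p h ω → Nat.card H = d * p →
        ∃ H' ∈ S, ConjugateIn (Hermitian.PGU p h ω) H H') ∧
    -- every subgroup of order `d * p` is conjugate to one on the list
    (∀ H : Subgroup PGL(3, K), H ≤ Hermitian.PGU p h ω → Nat.card H = d * p →
      (∃ l : Kˣ, orderOf l = d) ∧
      ∀ l : Kˣ, orderOf l = d →
        (d ∣ p ^ h + 1 ∧
          ConjugateIn (Hermitian.PGU p h ω) H (Hermitian.centralGroup (p ^ h) ω l)) ∨
        (d ∣ p - 1 ∧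
          ConjugateIn (Hermitian.PGU p h ω) H (Hermitian.centralGroup (p ^ h) ω l)) ∨
        (d ∣ p - 1 ∧
          ConjugateIn (Hermitian.PGU p h ω) H (Hermitian.noncentralGroup (p ^ h) ω l))) ∧
    -- the groups on the list have the stated structure
    (∀ l : Kˣ, orderOf l = d →
      Nat.card (Hermitian.sigmaCentral (p ^ h) ω) = p ∧
      Nat.card (Hermitian.sigmaNoncentral (p ^ h) ω) = p ∧
      Nat.card (Hermitian.sigmaDiag (p ^ h) ω l) = d ∧
      (d ∣ p ^ h + 1 →
        Hermitian.centralGroup (p ^ h) ω l ≤ Hermitian.stabYinf p h ω ∧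
        Nat.card (Hermitian.centralGroup (p ^ h) ω l) = d * p ∧
        IsInternalDirect (Hermitian.centralGroup (p ^ h) ω l)
          (Hermitian.sigmaCentral (p ^ h) ω) (Hermitian.sigmaDiag (p ^ h) ω l) ∧
        IsCyclic (Hermitian.centralGroup (p ^ h) ω l)) ∧
      (d ∣ p - 1 →
        Hermitian.centralGroup (p ^ h) ω l ≤ Hermitian.stabYinf p h ω ∧
        Nat.card (Hermitian.centralGroup (p ^ h) ω l) = d * p ∧
        IsInternalSemidirect (Hermitian.centralGroup (p ^ h) ω l)
          (Hermitian.sigmaCentral (p ^ h) ω) (Hermitian.sigmaDiag (p ^ h) ω l) ∧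
        ¬ ∀ x ∈ Hermitian.centralGroup (p ^ h) ω l,
            ∀ y ∈ Hermitian.centralGroup (p ^ h) ω l, x * y = y * x) ∧
      (d ∣ p - 1 →
        Hermitian.noncentralGroup (p ^ h) ω l ≤ Hermitian.stabYinf p h ω ∧
        Nat.card (Hermitian.noncentralGroup (p ^ h) ω l) = d * p ∧
        IsInternalSemidirect (Hermitian.noncentralGroup (p ^ h) ω l)
          (Hermitian.sigmaNoncentral (p ^ h) ω) (Hermitian.sigmaDiag (p ^ h) ω l) ∧
        ¬ ∀ x ∈ Hermitian.noncentralGroup (p ^ h) ω l,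
            ∀ y ∈ Hermitian.noncentralGroup (p ^ h) ω l, x * y = y * x)) := by
  obtain ⟨⟨S, hS, hS'⟩, hclass⟩ := theorem2_general p d h hd hp3 (by omega) hpd hK ω hω
  exact ⟨⟨S, by omega, hS'⟩, hclass⟩
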